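/- Let $\langle S,\varphi\rangle$ denote a closure system: a finite set $S$ with a closure operator $\varphi$ on its subsets. It is \emph{standard} if $\varphi(\emptyset)=\emptyset$ and $\varphi(\{i\})\setminus\{i\}$ is closed for every $i\in S$. A set $Q\subseteq S$ is \emph{quasi-closed} if it is not closed and $Q\cap X$ is closed for every closed $X\not\supseteq Q$; it is \emph{critical} if moreover no proper subset of $Q$ is quasi-closed with the same closure. The \emph{canonical basis} is the set of implications $\Sigma_C=\{C\to\varphi(C)\setminus C : C \text{ critical}\}$, and its \emph{size} $s(\Sigma_C)$ is the sum of the cardinalities of all its premises and conclusions. For $x\in S$, a set $X\subseteq S$ is a \emph{minimal cover} of $x$ if $x\in\varphi(X)$, $x\notin\varphi(\{y\})$ for all $y\in X$, and $X\subseteq Y$ for every $Y\subseteq S$ such that $x\in\varphi(Y)$ and every $y\in Y$ lies in $\varphi(\{z\})$ for some $z\in X$. Write $x\,D\,y$ if $y$ belongs to some minimal cover of $x$. The system is \emph{without $D$-cycles} if there are no $n>2$ and $x_1,\dots,x_n\in S$ with $x_i\,D\,x_{i+1}$ for $1\le i<n$ and $x_1=x_n$. \textbf{Theorem.} For a standard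 closure system $\langle S,\varphi\rangle$, being without $D$-cycles is equivalent to its lattice of closed sets being without $D$-cycles, where the $D$-relation of a finite lattice is defined on its join irreducible elements in the same way ($X$ is a minimal cover of $x$ if $x\le\bigvee X$, $x\not\le y$ for all $y\in X$, and $X\subseteq Y$ for every set $Y$ of join irreducibles such that $x\le\bigvee Y$ and every $y\in Y$ lies below some element of $X$). There is an algorithm (a multi-stack Turing machine) that, given the canonical basis $\Sigma_C$ of any finite standard closure system, decides in time polynomial in $s(\Sigma_C)$ whether the system is without $D$-cycles. Here the input lists the implications of $\Sigma_C$ in any order, each premise and each conclusion being written as a $0/1$-vector indexed by an arbitrary enumeration of the elements that occur in $\Sigma_C$; if the enumeration also contains elements of $S$ that do not occur in $\Sigma_C$, their number is added to $s(\Sigma_C)$ in the time bound. -/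

import Mathlib

namespace ClosureSys

/-! ### Finite lattices without `D`-cycles -/

section Lattices

variable {L : Type*} [Lattice L] [OrderBot L]

/-- `Y` refines `X`. -/
def Refines (Y X : Finset L) : Prop :=
  ∀ y ∈ Y, ∃ x ∈ X, y ≤ x

/-- `X` is a non-trivial cover of `x` by join irreducible elements. -/
def IsLatticeCover (X : Finset L) (x : L) : Prop :=
  (∀ y ∈ X, SupIrred y) ∧ x ≤ X.sup id ∧ ∀ y ∈ X, ¬ x ≤ y

/-- `X` is a (refinement-)minimal non-trivial cover of `x`. -/
def IsLatticeMinCover (X : Finset L) (x : L) : Prop :=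
  IsLatticeCover X x ∧
    ∀ Y : Finset L, (∀ y ∈ Y, SupIrred y) → x ≤ Y.sup id → Refines Y X → X ⊆ Y

/-- The `D`-relation on the join irreducible elements of `L`. -/
def LatticeD (x y : L) : Prop :=
  SupIrred x ∧ SupIrred y ∧ ∃ X : Finset L, IsLatticeMinCover X x ∧ y ∈ X

variable (L) in
/-- `L` has no `D`-cycle `x₁ D x₂ D ⋯ D xₙ = x₁` with `n > 2`. -/
def LatticeWithoutDCycles : Prop :=
  ¬ ∃ (n : ℕ) (x : ℕ → L), 2 < n ∧ (∀ i, 1 ≤ i → i < n → LatticeD (x i) (x (i + 1))) ∧ x 1 = x n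

end Lattices

/-! ### Finite closure systems `⟨S, φ⟩` -/

section Systems

variable {S : Type*} [Fintype S] [DecidableEq S] (φ : ClosureOperator (Finset S))

/-- The closure lattice `Cl(S, φ)`: closed sets ordered by inclusion, with join `φ (X ∪ Y)`
and meet `X ∩ Y`. -/
instance closedsLattice : Lattice φ.Closeds := φ.gi.liftLattice

instance closedsOrderBot : OrderBot φ.Closeds where
  bot := φ.toCloseds ∅
  bot_le _ := φ.gi.gc.l_le (Finset.empty_subset _)

/-- Standard closure systems. -/
def IsStandard : Prop :=
  φ ∅ = ∅ ∧ ∀ i : S, φ.IsClosed (φ {i} \ {i})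

/-- Quasi-closed sets. -/
def IsQuasiClosed (Q : Finset S) : Prop :=
  ¬ φ.IsClosed Q ∧ ∀ X : Finset S, φ.IsClosed X → ¬ Q ⊆ X → φ.IsClosed (Q ∩ X)

/-- Critical sets: the minimal quasi-closed sets among those with the same closure. -/
def IsCritical (C : Finset S) : Prop :=
  IsQuasiClosed φ C ∧ ∀ Q : Finset S, Q ⊆ C → IsQuasiClosed φ Q → φ Q = φ C → Q = C

open Classical in
/-- The canonical (Duquenne–Guigues) basis `{C → φ(C) \ C : C critical}`; an implication
`A → B` is the pair `(A, B)`. -/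
noncomputable def canonicalBasis : Finset (Finset S × Finset S) :=
  (Finset.univ.filter fun C => IsCritical φ C).image fun C => (C, φ C \ C)

/-- The size `s(Σ)`: the sum of the cardinalities of all premises and conclusions. -/
def basisSize (B : Finset (Finset S × Finset S)) : ℕ :=
  ∑ I ∈ B, (I.1.card + I.2.card)

/-- The elements of `S` that occur in some implication of the set `B`. -/
def occurring (B : Finset (Finset S × Finset S)) : Finset S :=
  B.biUnion fun I => I.1 ∪ I.2

/-- `X ⊆ S` is a non-trivial cover of `x`. Here `y ≤ z` in `S` means `y ∈ φ {z}`. -/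
def IsCover (X : Finset S) (x : S) : Prop :=
  x ∈ φ X ∧ ∀ y ∈ X, x ∉ φ {y}

/-- `X ⊆ S` is a (refinement-)minimal non-trivial cover of `x`. -/
def IsMinCover (X : Finset S) (x : S) : Prop :=
  IsCover φ X x ∧
    ∀ Y : Finset S, x ∈ φ Y → (∀ y ∈ Y, ∃ z ∈ X, y ∈ φ {z}) → X ⊆ Y

/-- The `D`-relation on `S`. -/
def DRel (x y : S) : Prop :=
  ∃ X : Finset S, IsMinCover φ X x ∧ y ∈ X

/-- The closure system has no `D`-cycle `x₁ D x₂ D ⋯ D xₙ = x₁` with `n > 2`. -/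
def WithoutDCycles : Prop :=
  ¬ ∃ (n : ℕ) (x : ℕ → S), 2 < n ∧ (∀ i, 1 ≤ i → i < n → DRel φ (x i) (x (i + 1))) ∧ x 1 = x n

end Systems

/-! ### Writing a set of implications as a word over the alphabet `{0, 1, separator}` -/

section Words

variable {S : Type*} [DecidableEq S]

/-- The characteristic vector of `A` along the enumeration `es`, followed by a separator. -/
def encodeSet (es : List S) (A : Finset S) : List (Option Bool) :=
  es.map (fun x => some (decide (x ∈ A))) ++ [none]

/-- The word of a list of implications: premise and conclusion of each, one after the other. -/
def encodeBasis (es : List S) (l : List (Finset S × Finset S)) : List (Option Bool) :=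
  l.flatMap fun I => encodeSet es I.1 ++ encodeSet es I.2

end Words

end ClosureSys

/-! Order `S` by `y ∈ φ {z}`. Standardness makes this a partial order, and `i ↦ φ {i}` is then an
isomorphism from `S` onto the join irreducible closed sets, carrying minimal covers to minimal
covers; this settles the comparison with the lattice.

Since `D` is irreflexive and `S` is finite, having no `D`-cycles means that `D` has no infinite
chain `x₁ D x₂ D ⋯`. The elements from which no such chain starts are collected in rounds, using the
canonical basis only. Put `T₀ = ∅`, and let `x` belong to `next T` if every implication `C → φ C \
C` with `2 ≤ |C|` and `x ∈ φ C \ C` still gives `x ∈ φ (C ∩ T)`. One-element premises merely express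
the order and play no part.

If `T ⊆ next T`, then `x ∈ next T` and `x D y` force `y ∈ T` (`DRel.mem_of_mem_next`): by
`mem_closure_inter_of_mem_next`, a derivation of `x` from the down-set of a minimal cover can be
confined to the part of that down-set in `T`, and minimality puts the whole cover into `T`. Hence
everything collected is accessible for `D`. Conversely, a critical set `C` with at least two
elements is a down-set (`IsCritical.isDown`), so an `x ∈ φ C \ C` has a minimal cover inside `C`
(`IsStandard.exists_isMinCover`). If `D` is well-founded, induction along it puts every enumerated
element into a `T` that has stabilised on the enumeration.

The rounds increase, so at most one more round is needed than there are enumerated elements. A round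
computes one closure per implication by forward chaining. The machine does this by while programs on
stacks, whose semantics `Exec` carries a step bound that is transferred to Mathlib's `TM2` machines
by `Exec.reachesIn`. -/

/-! ### While programs on stacks and their translation to stack machines -/

namespace StackProg

open Turing

variable {K : Type} {Γ : K → Type} {σ : Type}

/-- An atomic operation on the stacks and the register. -/
inductive Op (Γ : K → Type) (σ : Type)
  | push (k : K) (f : σ → Γ k) : Op Γ σ
  | peek (k : K) (f : σ → Option (Γ k) → σ) : Op Γ σ
  | pop (k : K) (f : σ → Option (Γ k) → σ) : Op Γ σ
  | load (f : σ → σ) : Op Γ σ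

/-- While programs over blocks of atomic operations. -/
inductive Prog (Γ : K → Type) (σ : Type)
  | block (os : List (Op Γ σ)) : Prog Γ σ
  | seq (p q : Prog Γ σ) : Prog Γ σ
  | loop (c : σ → Bool) (p : Prog Γ σ) : Prog Γ σ

/-- The effect of a block on the register and the stacks. -/
def runOps [DecidableEq K] : List (Op Γ σ) → σ → (∀ k, List (Γ k)) → σ × (∀ k, List (Γ k))
  | [], v, S => (v, S)
  | .push k f :: os, v, S => runOps os v (Function.update S k (f v :: S k))
  | .peek k f :: os, v, S => runOps os (f v (S k).head?) S
  | .pop k f :: os, v, S => runOps os (f v (S k).head?) (Function.update S k (S k).tail)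
  | .load f :: os, v, S => runOps os (f v) S

/-- `Exec p v S v' S' t`: started with register `v` and stacks `S`, the program `p` ends with
register `v'` and stacks `S'` after at most `t` steps. -/
inductive Exec [DecidableEq K] :
    Prog Γ σ → σ → (∀ k, List (Γ k)) → σ → (∀ k, List (Γ k)) → ℕ → Prop
  | mono {p v S v' S' t t'} : Exec p v S v' S' t → t ≤ t' → Exec p v S v' S' t'
  | block (os v S) : Exec (.block os) v S (runOps os v S).1 (runOps os v S).2 1
  | seq {p q v S v₁ S₁ v₂ S₂ t₁ t₂} : Exec p v S v₁ S₁ t₁ → Exec q v₁ S₁ v₂ S₂ t₂ →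
      Exec (.seq p q) v S v₂ S₂ (t₁ + t₂)
  | loop_false {c p v S} : c v = false → Exec (.loop c p) v S v S 1
  | loop_true {c p v S v₁ S₁ v₂ S₂ t₁ t₂} : c v = true → Exec p v S v₁ S₁ t₁ →
      Exec (.loop c p) v₁ S₁ v₂ S₂ t₂ → Exec (.loop c p) v S v₂ S₂ (t₁ + t₂ + 1)

/-- The control points of a program. -/
def Label : Prog Γ σ → Type
  | .block _ => Unit
  | .seq p q => Label p ⊕ Label q
  | .loop _ p => Option (Label p)

/-- A program has finitely many control points. -/
@[reducible] def labelFintype : ∀ p : Prog Γ σ, Fintype (Label p)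
  | .block _ => inferInstanceAs (Fintype Unit)
  | .seq p q => @instFintypeSum _ _ (labelFintype p) (labelFintype q)
  | .loop _ p => @instFintypeOption _ (labelFintype p)

/-- The first control point of a program. -/
def entry : ∀ p : Prog Γ σ, Label p
  | .block _ => ()
  | .seq p _ => Sum.inl (entry p)
  | .loop _ _ => none

/-- A block, followed by a statement. -/
def blockCode {Λ : Type} : List (Op Γ σ) → TM2.Stmt Γ Λ σ → TM2.Stmt Γ Λ σ
  | [], s => s
  | .push k f :: os, s => .push k f (blockCode os s)
  | .peek k f :: os, s => .peek k f (blockCode os s)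
  | .pop k f :: os, s => .pop k f (blockCode os s)
  | .load f :: os, s => .load f (blockCode os s)

/-- The statement at each control point; `next` is performed when the program ends. -/
def code {Λ : Type} : ∀ p : Prog Γ σ, (Label p → Λ) → TM2.Stmt Γ Λ σ → Label p → TM2.Stmt Γ Λ σ
  | .block os, _, next, _ => blockCode os next
  | .seq p q, emb, next, l =>
      Sum.elim (code p (emb ∘ Sum.inl) (.goto fun _ => emb (Sum.inr (entry q))))
        (code q (emb ∘ Sum.inr) next) l
  | .loop c p, emb, next, l =>
      Option.elim l (.branch c (.goto fun _ => emb (some (entry p))) next)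
        (code p (emb ∘ some) (.goto fun _ => emb none))

/-! ### Simulation of while programs by machines, with step counts. -/

variable [DecidableEq K] {Λ : Type}

/-- The machine with program `M` goes from `a` to `b` in at most `t` steps. -/
def ReachesIn (M : Λ → TM2.Stmt Γ Λ σ) (a b : TM2.Cfg Γ Λ σ) (t : ℕ) : Prop :=
  Nonempty (StateTransition.EvalsToInTime (TM2.step M) a (some b) t)

theorem ReachesIn.trans {M : Λ → TM2.Stmt Γ Λ σ} {a b c : TM2.Cfg Γ Λ σ} {t₁ t₂ : ℕ}
    (h₁ : ReachesIn M a b t₁) (h₂ : ReachesIn M b c t₂) : ReachesIn M a c (t₁ + t₂) := by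
  obtain ⟨h₁⟩ := h₁
  obtain ⟨h₂⟩ := h₂
  rw [add_comm]
  exact ⟨h₁.trans _ _ _ _ _ _ h₂⟩

theorem ReachesIn.mono {M : Λ → TM2.Stmt Γ Λ σ} {a b : TM2.Cfg Γ Λ σ} {t₁ t₂ : ℕ}
    (h : ReachesIn M a b t₁) (ht : t₁ ≤ t₂) : ReachesIn M a b t₂ := by
  obtain ⟨h⟩ := h
  exact ⟨⟨h.toEvalsTo, h.steps_le_m.trans ht⟩⟩

theorem ReachesIn.step {M : Λ → TM2.Stmt Γ Λ σ} (l : Λ) (v : σ) (S : ∀ k, List (Γ k)) :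
    ReachesIn M ⟨some l, v, S⟩ (TM2.stepAux (M l) v S) 1 :=
  ⟨⟨⟨1, rfl⟩, le_rfl⟩⟩

/-- A `TM2` machine runs a whole statement up to the next jump in a single step; hence `Exec`
charges one step for a block of any length. -/
theorem stepAux_blockCode (os : List (Op Γ σ)) (next : TM2.Stmt Γ Λ σ) (v : σ)
    (S : ∀ k, List (Γ k)) :
    TM2.stepAux (blockCode os next) v S = TM2.stepAux next (runOps os v S).1 (runOps os v S).2 := by
  induction os generalizing v S with
  | nil => rfl
  | cons o os ih => cases o <;> simp [blockCode, runOps, ih]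

/-- A machine that contains the code of `p` performs `p`. -/
theorem Exec.reachesIn {p : Prog Γ σ} {v : σ} {S : ∀ k, List (Γ k)} {v' : σ}
    {S' : ∀ k, List (Γ k)} {t : ℕ} (h : Exec p v S v' S' t) (M : Λ → TM2.Stmt Γ Λ σ)
    (emb : Label p → Λ) (next : TM2.Stmt Γ Λ σ) (hM : ∀ l, M (emb l) = code p emb next l) :
    ReachesIn M ⟨some (emb (entry p)), v, S⟩ (TM2.stepAux next v' S') t := by
  induction h generalizing next with
  | block os v S =>
    have := ReachesIn.step (M := M) (emb (entry (.block os))) v S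
    rwa [hM, code, stepAux_blockCode] at this
  | @seq p q v S v₁ S₁ v₂ S₂ t₁ t₂ _ _ ih₁ ih₂ =>
    exact (ih₁ (emb ∘ Sum.inl) _ fun l => hM (Sum.inl l)).trans
      (ih₂ (emb ∘ Sum.inr) next fun l => hM (Sum.inr l))
  | @loop_false c p v S hc =>
    have := ReachesIn.step (M := M) (emb (entry (.loop c p))) v S
    rw [hM] at this
    simpa [code, entry, hc] using this
  | @loop_true c p v S v₁ S₁ v₂ S₂ t₁ t₂ hc _ _ ih₁ ih₂ =>
    have := ReachesIn.step (M := M) (emb (entry (.loop c p))) v S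
    rw [hM] at this
    simp only [code, entry, Option.elim, TM2.stepAux, hc, cond_true] at this
    refine (this.trans ((ih₁ (emb ∘ some) _ fun l => hM (some l)).trans (ih₂ emb next hM))).mono ?_
    omega
  | mono _ ht ih => exact (ih emb next hM).mono ht

end StackProg

/-! ### The machine -/

namespace DCycleMachine

open StackProg

/-- The stacks: two copies of the implications, each with a stack for the part already passed,
the working vector with a stack for the part already passed, and the output. -/
inductive Stack
  | outer | outerPassed | inner | innerPassed | vec | vecPassed | out
  deriving DecidableEq

instance : Fintype Stack where
  elems := {.outer, .outerPassed, .inner, .innerPassed, .vec, .vecPassed, .out}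
  complete k := by cases k <;> simp

/-- For one element: whether it lies in the set `T` computed so far, in the set `U` that is to
replace `T`, and in the closure being computed. -/
abbrev Cell := Bool × Bool × Bool

/-- The stack alphabets. -/
def Sym : Stack → Type
  | .outer | .outerPassed | .inner | .innerPassed => Option Bool
  | .vec | .vecPassed => Cell
  | .out => Bool

/-- Boolean registers. -/
structure Flags where
  ok : Bool
  grown : Bool
  changed : Bool
  one : Bool
  two : Bool
  deriving Fintype

/-- The register: the last symbols read, and the Boolean registers. -/
structure Reg where
  sym : Option (Option Bool)
  cell : Option Cell
  flags : Flags
  deriving Fintype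

/-- The stacks with the given contents. -/
def stk (p p' q q' : List (Option Bool)) (w w' : List Cell) (o : List Bool) :
    ∀ k, List (Sym k)
  | .outer => p
  | .outerPassed => p'
  | .inner => q
  | .innerPassed => q'
  | .vec => w
  | .vecPassed => w'
  | .out => o

/-- Programs of the machine. -/
abbrev P := Prog Sym Reg

/-- A block with a described effect. -/
theorem exec_block {os : List (Op Sym Reg)} {v v' : Reg} {S S' : ∀ k, List (Sym k)}
    (hv : (runOps os v S).1 = v') (hS : ∀ k, (runOps os v S).2 k = S' k) :
    Exec (.block os) v S v' S' 1 := by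
  have := Exec.block os v S
  rwa [hv, funext hS] at this

/-! #### Reading and writing the registers -/

/-- Store a symbol of the implications. -/
def Reg.setSym (v : Reg) (a : Option (Option Bool)) : Reg := { v with sym := a }

/-- Store a cell. -/
def Reg.setCell (v : Reg) (a : Option Cell) : Reg := { v with cell := a }

/-- Forget the symbols read. -/
def Reg.clear (v : Reg) : Reg := ⟨none, none, v.flags⟩

/-- Whether the symbol read is a bit. -/
def Reg.isBit (v : Reg) : Bool := v.sym.join.isSome

/-- The bit read. -/
def Reg.bit (v : Reg) : Bool := v.sym.join.getD false

/-- The symbol read. -/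
def Reg.getSym (v : Reg) : Option Bool := v.sym.join

/-- The cell read. -/
def Reg.getCell (v : Reg) : Cell := v.cell.getD (false, false, false)

/-- Whether a symbol was read. -/
def Reg.hasSym (v : Reg) : Bool := v.sym.isSome

/-- Whether a cell was read. -/
def Reg.hasCell (v : Reg) : Bool := v.cell.isSome

/-- Change the Boolean registers. -/
def Reg.mapFlags (f : Flags → Flags) (v : Reg) : Reg := { v with flags := f v.flags }

/-! #### Passing along vectors -/

/-- Move the passed part of the vector back. -/
def rewind : P :=
  .seq (.block [.pop .vecPassed Reg.setCell])
    (.loop Reg.hasCell (.block [.push .vec Reg.getCell, .pop .vecPassed Reg.setCell]))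

theorem exec_rewind (s : Option (Option Bool)) (c : Option Cell) (f : Flags)
    (p p' q q' : List (Option Bool)) (w w' : List Cell) (o : List Bool) :
    Exec rewind ⟨s, c, f⟩ (stk p p' q q' w w' o) ⟨s, none, f⟩
      (stk p p' q q' (w'.reverse ++ w) [] o) (2 * w'.length + 2) := by
  -- Loop invariant: the top symbol is already in the register, the rest is on the stack. Popping an
  -- empty stack yields `none`, which ends the loop. The other loops below read ahead in the same
  -- way.
  have main : ∀ (w' w : List Cell), Exec (.loop Reg.hasCell
      (.block [.push .vec Reg.getCell, .pop .vecPassed Reg.setCell]))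
      (⟨s, w'.head?, f⟩ : Reg) (stk p p' q q' w w'.tail o) ⟨s, none, f⟩
      (stk p p' q q' (w'.reverse ++ w) [] o) (2 * w'.length + 1) := by
    intro w'
    induction w' with
    | nil => exact fun w => .loop_false rfl
    | cons a w' ih =>
      intro w
      have := (Exec.loop_true (v := ⟨s, some a, f⟩) (S := stk p p' q q' w w' o) rfl
        (exec_block rfl (by rintro (_ | _) <;> rfl)) (ih (a :: w))).mono
        (t' := 2 * (w'.length + 1) + 1) (by omega)
      simpa using this
  refine (Exec.seq (exec_block rfl (by rintro (_ | _) <;> rfl)) (main w' w)).mono ?_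
  omega

/-- Pass along a set of the outer list of implications and the vector. -/
def outerSweep (g : Flags → Bool → Cell → Cell) (h : Flags → Bool → Cell → Flags) : P :=
  .seq (.block [.pop .outer Reg.setSym])
    (.seq (.loop Reg.isBit (.block [.pop .vec Reg.setCell, .push .outerPassed Reg.getSym,
        .push .vecPassed fun v => g v.flags v.bit v.getCell,
        .load fun v => v.mapFlags fun f => h f v.bit v.getCell, .pop .outer Reg.setSym]))
      (.block [.push .outerPassed fun _ => none, .load Reg.clear]))

/-- Pass along a set of the inner list of implications and the vector. -/
def innerSweep (g : Flags → Bool → Cell → Cell) (h : Flags → Bool → Cell → Flags) : P :=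
  .seq (.block [.pop .inner Reg.setSym])
    (.seq (.loop Reg.isBit (.block [.pop .vec Reg.setCell, .push .innerPassed Reg.getSym,
        .push .vecPassed fun v => g v.flags v.bit v.getCell,
        .load fun v => v.mapFlags fun f => h f v.bit v.getCell, .pop .inner Reg.setSym]))
      (.block [.push .innerPassed fun _ => none, .load Reg.clear]))

variable {S : Type*}

/-- By `hg` the new cells do not depend on the flags that `h` changes, so the vector is transformed
by a plain map with the initial flags while the flags undergo a fold. -/
theorem exec_outerSweep (g : Flags → Bool → Cell → Cell) (h : Flags → Bool → Cell → Flags)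
    (hg : ∀ f b c, g (h f b c) = g f) (β : S → Bool) (γ : S → Cell) (es : List S) (v : Reg)
    (p p' q q' : List (Option Bool)) (o : List Bool) :
    Exec (outerSweep g h) v
      (stk (es.map (fun e => some (β e)) ++ none :: p) p' q q' (es.map γ) [] o)
      ⟨none, none, es.foldl (fun f e => h f (β e) (γ e)) v.flags⟩
      (stk p (none :: (es.map fun e => some (β e)).reverse ++ p') q q' []
        (es.map fun e => g v.flags (β e) (γ e)).reverse o) (2 * es.length + 3) := by
  have main : ∀ (es : List S) (f : Flags) (c : Option Cell) (p' : List (Option Bool))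
      (w' : List Cell), ∃ c', Exec (.loop Reg.isBit (.block [.pop .vec Reg.setCell,
        .push .outerPassed Reg.getSym, .push .vecPassed fun v => g v.flags v.bit v.getCell,
        .load fun v => v.mapFlags fun f => h f v.bit v.getCell, .pop .outer Reg.setSym]))
      (⟨(es.map (fun e => some (β e)) ++ none :: p).head?, c, f⟩ : Reg)
      (stk (es.map (fun e => some (β e)) ++ none :: p).tail p' q q' (es.map γ) w' o)
      ⟨some none, c', es.foldl (fun f e => h f (β e) (γ e)) f⟩
      (stk p ((es.map fun e => some (β e)).reverse ++ p') q q' []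
        ((es.map fun e => g f (β e) (γ e)).reverse ++ w') o) (2 * es.length + 1) := by
    intro es
    induction es with
    | nil => exact fun f c p' w' => ⟨c, .loop_false rfl⟩
    | cons e es ih =>
      intro f c p' w'
      obtain ⟨c', hc'⟩ := ih (h f (β e) (γ e)) (some (γ e)) (some (β e) :: p')
        (g f (β e) (γ e) :: w')
      have := (Exec.loop_true (v := ⟨some (some (β e)), c, f⟩)
        (S := stk (es.map (fun e => some (β e)) ++ none :: p) p' q q' (γ e :: es.map γ) w' o)
        rfl (exec_block rfl (by rintro (_ | _) <;> rfl)) hc').mono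
        (t' := 2 * (es.length + 1) + 1) (by omega)
      exact ⟨c', by simpa [hg] using this⟩
  obtain ⟨c', hc'⟩ := main es v.flags v.cell p' []
  rw [List.append_nil] at hc'
  refine (Exec.seq (exec_block ?_ ?_) (Exec.seq hc' (exec_block ?_ ?_))).mono ?_
  all_goals first | rfl | (rintro (_ | _) <;> rfl) | omega

theorem exec_innerSweep (g : Flags → Bool → Cell → Cell) (h : Flags → Bool → Cell → Flags)
    (hg : ∀ f b c, g (h f b c) = g f) (β : S → Bool) (γ : S → Cell) (es : List S) (v : Reg)
    (p p' q q' : List (Option Bool)) (o : List Bool) :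
    Exec (innerSweep g h) v
      (stk p p' (es.map (fun e => some (β e)) ++ none :: q) q' (es.map γ) [] o)
      ⟨none, none, es.foldl (fun f e => h f (β e) (γ e)) v.flags⟩
      (stk p p' q (none :: (es.map fun e => some (β e)).reverse ++ q') []
        (es.map fun e => g v.flags (β e) (γ e)).reverse o) (2 * es.length + 3) := by
  have main : ∀ (es : List S) (f : Flags) (c : Option Cell) (q' : List (Option Bool))
      (w' : List Cell), ∃ c', Exec (.loop Reg.isBit (.block [.pop .vec Reg.setCell,
        .push .innerPassed Reg.getSym, .push .vecPassed fun v => g v.flags v.bit v.getCell,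
        .load fun v => v.mapFlags fun f => h f v.bit v.getCell, .pop .inner Reg.setSym]))
      (⟨(es.map (fun e => some (β e)) ++ none :: q).head?, c, f⟩ : Reg)
      (stk p p' (es.map (fun e => some (β e)) ++ none :: q).tail q' (es.map γ) w' o)
      ⟨some none, c', es.foldl (fun f e => h f (β e) (γ e)) f⟩
      (stk p p' q ((es.map fun e => some (β e)).reverse ++ q') []
        ((es.map fun e => g f (β e) (γ e)).reverse ++ w') o) (2 * es.length + 1) := by
    intro es
    induction es with
    | nil => exact fun f c p' w' => ⟨c, .loop_false rfl⟩
    | cons e es ih =>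
      intro f c q' w'
      obtain ⟨c', hc'⟩ := ih (h f (β e) (γ e)) (some (γ e)) (some (β e) :: q')
        (g f (β e) (γ e) :: w')
      have := (Exec.loop_true (v := ⟨some (some (β e)), c, f⟩)
        (S := stk p p' (es.map (fun e => some (β e)) ++ none :: q) q' (γ e :: es.map γ) w' o)
        rfl (exec_block rfl (by rintro (_ | _) <;> rfl)) hc').mono
        (t' := 2 * (es.length + 1) + 1) (by omega)
      exact ⟨c', by simpa [hg] using this⟩
  obtain ⟨c', hc'⟩ := main es v.flags v.cell q' []
  rw [List.append_nil] at hc'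
  refine (Exec.seq (exec_block ?_ ?_) (Exec.seq hc' (exec_block ?_ ?_))).mono ?_
  all_goals first | rfl | (rintro (_ | _) <;> rfl) | omega

open ClosureSys

/-- Move the passed part of the outer list of implications back. -/
def restoreOuter : P :=
  .seq (.block [.load Reg.clear, .pop .outerPassed Reg.setSym])
    (.loop Reg.hasSym (.block [.push .outer Reg.getSym, .pop .outerPassed Reg.setSym]))

/-- Move the passed part of the inner list of implications back. -/
def restoreInner : P :=
  .seq (.block [.load Reg.clear, .pop .innerPassed Reg.setSym])
    (.loop Reg.hasSym (.block [.push .inner Reg.getSym, .pop .innerPassed Reg.setSym]))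

theorem exec_restoreOuter (s : Option (Option Bool)) (c : Option Cell) (f : Flags)
    (p p' q q' : List (Option Bool)) (w w' : List Cell) (o : List Bool) :
    Exec restoreOuter ⟨s, c, f⟩ (stk p p' q q' w w' o) ⟨none, none, f⟩
      (stk (p'.reverse ++ p) [] q q' w w' o) (2 * p'.length + 2) := by
  have main : ∀ (p' p : List (Option Bool)), Exec (.loop Reg.hasSym
      (.block [.push .outer Reg.getSym, .pop .outerPassed Reg.setSym]))
      (⟨p'.head?, none, f⟩ : Reg) (stk p p'.tail q q' w w' o) ⟨none, none, f⟩
      (stk (p'.reverse ++ p) [] q q' w w' o) (2 * p'.length + 1) := by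
    intro p'
    induction p' with
    | nil => exact fun w => .loop_false rfl
    | cons a p' ih =>
      intro p
      have := (Exec.loop_true (v := ⟨some a, none, f⟩) (S := stk p p' q q' w w' o) rfl
        (exec_block rfl (by rintro (_ | _) <;> rfl)) (ih (a :: p))).mono
        (t' := 2 * (p'.length + 1) + 1) (by omega)
      simpa using this
  refine (Exec.seq (exec_block rfl (by rintro (_ | _) <;> rfl)) (main p' p)).mono ?_
  omega

theorem exec_restoreInner (s : Option (Option Bool)) (c : Option Cell) (f : Flags)
    (p p' q q' : List (Option Bool)) (w w' : List Cell) (o : List Bool) :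
    Exec restoreInner ⟨s, c, f⟩ (stk p p' q q' w w' o) ⟨none, none, f⟩
      (stk p p' (q'.reverse ++ q) [] w w' o) (2 * q'.length + 2) := by
  have main : ∀ (q' q : List (Option Bool)), Exec (.loop Reg.hasSym
      (.block [.push .inner Reg.getSym, .pop .innerPassed Reg.setSym]))
      (⟨q'.head?, none, f⟩ : Reg) (stk p p' q q'.tail w w' o) ⟨none, none, f⟩
      (stk p p' (q'.reverse ++ q) [] w w' o) (2 * q'.length + 1) := by
    intro q'
    induction q' with
    | nil => exact fun w => .loop_false rfl
    | cons a q' ih =>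
      intro q
      have := (Exec.loop_true (v := ⟨some a, none, f⟩) (S := stk p p' q q' w w' o) rfl
        (exec_block rfl (by rintro (_ | _) <;> rfl)) (ih (a :: q))).mono
        (t' := 2 * (q'.length + 1) + 1) (by omega)
      simpa using this
  refine (Exec.seq (exec_block rfl (by rintro (_ | _) <;> rfl)) (main q' q)).mono ?_
  omega

/-! ### Boolean registers accumulated along a vector. -/

theorem foldl_ok (es : List S) (X : S → Bool) (f : Flags) :
    es.foldl (fun f e => { f with ok := f.ok && X e }) f = { f with ok := f.ok && es.all X } := by
  induction es generalizing f with
  | nil => simp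
  | cons e es ih => simp [ih, Bool.and_assoc]

theorem foldl_grown (es : List S) (X : S → Bool) (f : Flags) :
    es.foldl (fun f e => { f with grown := f.grown || (f.ok && X e) }) f =
      { f with grown := f.grown || (f.ok && es.any X) } := by
  induction es generalizing f with
  | nil => simp
  | cons e es ih => simp [ih, Bool.or_assoc, Bool.and_or_distrib_left]

theorem foldl_changed (es : List S) (X : S → Bool) (f : Flags) :
    es.foldl (fun f e => { f with changed := f.changed || X e }) f =
      { f with changed := f.changed || es.any X } := by
  induction es generalizing f with
  | nil => simp
  | cons e es ih => simp [ih, Bool.or_assoc]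

/-- The flags `one` and `two` form a counter that saturates at two, enough to test `2 ≤ |C|` for a
premise `C`. -/
theorem foldl_count (es : List S) (X : S → Bool) (ok grown changed : Bool) (k : ℕ) :
    es.foldl (fun f e => { f with one := f.one || X e, two := f.two || (f.one && X e) })
      (⟨ok, grown, changed, decide (1 ≤ k), decide (2 ≤ k)⟩ : Flags) =
      ⟨ok, grown, changed, decide (1 ≤ k + es.countP X), decide (2 ≤ k + es.countP X)⟩ := by
  induction es generalizing k with
  | nil => simp
  | cons e es ih =>
    have : (⟨ok, grown, changed, decide (1 ≤ k) || X e, decide (2 ≤ k) || (decide (1 ≤ k) && X e)⟩ :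
        Flags) = ⟨ok, grown, changed, decide (1 ≤ k + if X e then 1 else 0),
          decide (2 ≤ k + if X e then 1 else 0)⟩ := by
      cases X e
      · simp
      · simp only [Bool.or_true, Bool.and_true, if_true, Flags.mk.injEq, true_and]
        constructor
        · simp
        · rw [← Bool.decide_or]; congr 1; apply propext; omega
    rw [List.foldl_cons, List.countP_cons, this, ih]
    simp only [add_assoc, add_comm (List.countP X es)]

variable [DecidableEq S]

/-- The vector of the sets `T`, `U`, `A`. -/
def cells (es : List S) (T U A : Finset S) : List Cell :=
  es.map fun e => (decide (e ∈ T), decide (e ∈ U), decide (e ∈ A))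

theorem countP_mem_eq_card {es : List S} (hes : es.Nodup) {C : Finset S} (hC : C ⊆ es.toFinset) :
    es.countP (fun e => decide (e ∈ C)) = C.card := by
  rw [List.countP_eq_length_filter, ← List.toFinset_card_of_nodup (hes.filter _)]
  congr 1
  ext x
  simpa using fun h => List.mem_toFinset.1 (hC h)

/-! #### Closure under the implications -/

/-- Apply an implication to a set. -/
def fire (A : Finset S) (I : Finset S × Finset S) : Finset S :=
  if I.1 ⊆ A then A ∪ I.2 else A

theorem subset_fire (A : Finset S) (I : Finset S × Finset S) : A ⊆ fire A I := by
  unfold fire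
  split_ifs
  · exact Finset.subset_union_left
  · exact subset_rfl

theorem subset_foldl_fire (l : List (Finset S × Finset S)) (A : Finset S) :
    A ⊆ l.foldl fire A := by
  induction l generalizing A with
  | nil => exact subset_rfl
  | cons I l ih => exact (subset_fire A I).trans (ih _)

/-- Apply the next implication of the inner list. -/
def innerStep : P :=
  .seq (.block [.load (Reg.mapFlags fun f => { f with ok := true })])
    (.seq (innerSweep (fun _ _ c => c) fun f b c => { f with ok := f.ok && (!b || c.2.2) })
    (.seq rewind
    (.seq (innerSweep (fun f b c => (c.1, c.2.1, c.2.2 || (f.ok && b)))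
      fun f b c => { f with grown := f.grown || (f.ok && (b && !c.2.2)) })
    (.seq rewind
    (.block [.load (Reg.mapFlags fun f => { f with ok := false }), .peek .inner Reg.setSym])))))

theorem exec_innerStep {es : List S} {I : Finset S × Finset S} (h₁ : I.1 ⊆ es.toFinset)
    (h₂ : I.2 ⊆ es.toFinset) (T U A : Finset S) (s : Option (Option Bool)) (c : Option Cell)
    (g ch one two : Bool) (p p' q q' : List (Option Bool)) (o : List Bool) :
    Exec innerStep ⟨s, c, ⟨false, g, ch, one, two⟩⟩
      (stk p p' (encodeSet es I.1 ++ encodeSet es I.2 ++ q) q' (cells es T U A) [] o)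
      ⟨q.head?, none, ⟨false, g || decide (fire A I ≠ A), ch, one, two⟩⟩
      (stk p p' q ((encodeSet es I.1 ++ encodeSet es I.2).reverse ++ q')
        (cells es T U (fire A I)) [] o) (8 * es.length + 12) := by
  have test := exec_innerSweep (fun _ _ c => c)
    (fun f b c => { f with ok := f.ok && (!b || c.2.2) }) (fun _ _ _ => rfl)
    (fun e => decide (e ∈ I.1)) (fun e => (decide (e ∈ T), decide (e ∈ U), decide (e ∈ A))) es
    ⟨s, c, ⟨true, g, ch, one, two⟩⟩ p p' (encodeSet es I.2 ++ q) q' o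
  rw [foldl_ok es (fun e => !decide (e ∈ I.1) || decide (e ∈ A))] at test
  -- Testing along `es` suffices because `es` contains the whole premise.
  have hok : (es.all fun e => !decide (e ∈ I.1) || decide (e ∈ A)) = decide (I.1 ⊆ A) := by
    rw [Bool.eq_iff_iff]
    simp only [List.all_eq_true, Bool.or_eq_true, Bool.not_eq_true', decide_eq_false_iff_not,
      decide_eq_true_eq]
    exact ⟨fun h e he => (h e (List.mem_toFinset.1 (h₁ he))).resolve_left (not_not.2 he),
      fun h e _ => or_iff_not_imp_left.2 fun he => h (not_not.1 he)⟩
  simp only [hok, Bool.true_and] at test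
  have rew := exec_rewind none none ⟨decide (I.1 ⊆ A), g, ch, one, two⟩ p p'
    (encodeSet es I.2 ++ q) (none :: (es.map fun e => some (decide (e ∈ I.1))).reverse ++ q')
    [] (cells es T U A).reverse o
  have app := exec_innerSweep (fun f b c => (c.1, c.2.1, c.2.2 || (f.ok && b)))
    (fun f b c => { f with grown := f.grown || (f.ok && (b && !c.2.2)) }) (fun _ _ _ => rfl)
    (fun e => decide (e ∈ I.2)) (fun e => (decide (e ∈ T), decide (e ∈ U), decide (e ∈ A))) es
    ⟨none, none, ⟨decide (I.1 ⊆ A), g, ch, one, two⟩⟩ p p' q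
    (none :: (es.map fun e => some (decide (e ∈ I.1))).reverse ++ q') o
  rw [foldl_grown es (fun e => decide (e ∈ I.2) && !decide (e ∈ A))] at app
  have hany : (decide (I.1 ⊆ A) && es.any fun e => decide (e ∈ I.2) && !decide (e ∈ A)) =
      decide (fire A I ≠ A) := by
    rw [Bool.eq_iff_iff, fire]
    simp only [Bool.and_eq_true, List.any_eq_true, Bool.not_eq_true', decide_eq_false_iff_not,
      decide_eq_true_eq]
    split_ifs with h
    · rw [Ne, Finset.union_eq_left, Finset.not_subset]
      exact ⟨fun ⟨_, e, _, he⟩ => ⟨e, he⟩,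
        fun ⟨e, he⟩ => ⟨h, e, List.mem_toFinset.1 (h₂ he.1), he⟩⟩
    · simp [h]
  have hmap : (es.map fun e => (decide (e ∈ T), decide (e ∈ U),
      decide (e ∈ A) || (decide (I.1 ⊆ A) && decide (e ∈ I.2)))) = cells es T U (fire A I) := by
    refine List.map_congr_left fun e _ => ?_
    by_cases h : I.1 ⊆ A <;> simp [fire, h]
  simp only [hany, hmap] at app
  have rew' := exec_rewind none none ⟨decide (I.1 ⊆ A), g || decide (fire A I ≠ A), ch, one, two⟩
    p p' q (none :: (es.map fun e => some (decide (e ∈ I.2))).reverse ++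
      (none :: (es.map fun e => some (decide (e ∈ I.1))).reverse ++ q'))
    [] (cells es T U (fire A I)).reverse o
  simp only [List.reverse_reverse, List.append_nil, List.length_reverse] at rew rew'
  have hq : (stk p p' (encodeSet es I.1 ++ encodeSet es I.2 ++ q) q' (cells es T U A) [] o) =
      stk p p' (es.map (fun e => some (decide (e ∈ I.1))) ++ none :: (encodeSet es I.2 ++ q)) q'
        (cells es T U A) [] o := by simp [encodeSet]
  have hq' : encodeSet es I.2 ++ q = es.map (fun e => some (decide (e ∈ I.2))) ++ none :: q := by
    simp [encodeSet]
  rw [hq]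
  rw [hq'] at rew
  have hr : (encodeSet es I.1 ++ encodeSet es I.2).reverse ++ q' =
      none :: (es.map fun e => some (decide (e ∈ I.2))).reverse ++
      (none :: (es.map fun e => some (decide (e ∈ I.1))).reverse ++ q') := by
    simp [encodeSet]
  rw [hr]
  have len : (cells es T U A).length = es.length := by simp [cells]
  have len' : (cells es T U (fire A I)).length = es.length := by simp [cells]
  rw [hq'] at test ⊢
  refine (Exec.seq (exec_block ?_ ?_) (Exec.seq test (Exec.seq rew (Exec.seq app
    (Exec.seq rew' (exec_block ?_ ?_)))))).mono ?_
  all_goals first | rfl | (rintro (_ | _) <;> rfl) | omega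

/-- Apply all implications of the inner list once. -/
def innerRound : P :=
  .seq (.block [.load (Reg.mapFlags fun f => { f with grown := false }), .peek .inner Reg.setSym])
    (.seq (.loop Reg.hasSym innerStep) restoreInner)

theorem length_encodeBasis (es : List S) (l : List (Finset S × Finset S)) :
    (encodeBasis es l).length = 2 * (l.length * (es.length + 1)) := by
  induction l with
  | nil => simp [encodeBasis]
  | cons I l ih =>
    rw [encodeBasis, List.flatMap_cons, List.length_append, ← encodeBasis, ih]
    simp [encodeSet]
    ring

/-- Every set in the implications is given by its elements in `es`. -/
def Covers (es : List S) (l : List (Finset S × Finset S)) : Prop :=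
  ∀ I ∈ l, I.1 ⊆ es.toFinset ∧ I.2 ⊆ es.toFinset

/-- Even over an empty enumeration an implication contributes separators, so the presence of a
symbol tells whether an implication is left. -/
theorem head?_encodeBasis_cons (es : List S) (I : Finset S × Finset S)
    (l : List (Finset S × Finset S)) : ∃ a, (encodeBasis es (I :: l)).head? = some a := by
  cases es <;> simp [encodeBasis, encodeSet]

theorem exec_innerRound {es : List S} {l : List (Finset S × Finset S)} (hl : Covers es l)
    (T U A : Finset S) (s : Option (Option Bool)) (c : Option Cell)
    (g ch one two : Bool) (p p' : List (Option Bool)) (o : List Bool) :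
    Exec innerRound ⟨s, c, ⟨false, g, ch, one, two⟩⟩
      (stk p p' (encodeBasis es l) [] (cells es T U A) [] o)
      ⟨none, none, ⟨false, decide (l.foldl fire A ≠ A), ch, one, two⟩⟩
      (stk p p' (encodeBasis es l) [] (cells es T U (l.foldl fire A)) [] o)
      (17 * (l.length * (es.length + 1)) + 4) := by
  have main : ∀ (l : List (Finset S × Finset S)), Covers es l → ∀ (A : Finset S)
      (c : Option Cell) (g : Bool) (q' : List (Option Bool)), ∃ c',
      Exec (.loop Reg.hasSym innerStep)
      ⟨(encodeBasis es l).head?, c, ⟨false, g, ch, one, two⟩⟩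
      (stk p p' (encodeBasis es l) q' (cells es T U A) [] o)
      ⟨none, c', ⟨false, g || decide (l.foldl fire A ≠ A), ch, one, two⟩⟩
      (stk p p' [] ((encodeBasis es l).reverse ++ q') (cells es T U (l.foldl fire A)) [] o)
      (l.length * (8 * es.length + 13) + 1) := by
    intro l
    induction l with
    | nil =>
      intro _ A c g q'
      simp only [encodeBasis, List.flatMap_nil, List.head?_nil, List.foldl_nil, ne_eq,
        not_true_eq_false, decide_false, Bool.or_false, List.reverse_nil, List.nil_append]
      exact ⟨c, (Exec.loop_false rfl).mono (by omega)⟩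
    | cons I l ih =>
      intro hl A c g q'
      have hI := hl I (by simp)
      obtain ⟨c', h'⟩ := ih (fun J hJ => hl J (by simp [hJ])) (fire A I) none
        (g || decide (fire A I ≠ A)) ((encodeSet es I.1 ++ encodeSet es I.2).reverse ++ q')
      obtain ⟨a, ha⟩ := head?_encodeBasis_cons es I l
      have hs := exec_innerStep hI.1 hI.2 T U A (some a) c g ch one two p p' (encodeBasis es l) q' o
      have hc : encodeSet es I.1 ++ encodeSet es I.2 ++ encodeBasis es l =
          encodeBasis es (I :: l) := rfl
      rw [hc] at hs
      have := (Exec.loop_true rfl hs h').mono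
        (t' := (l.length + 1) * (8 * es.length + 13) + 1) (by ring_nf; omega)
      -- As `fire` only enlarges sets, the whole pass changes `A` exactly if its first implication
      -- or the remaining ones change something.
      have hg : (g || decide (fire A I ≠ A) || decide (l.foldl fire (fire A I) ≠ fire A I)) =
          (g || decide (l.foldl fire (fire A I) ≠ A)) := by
        rw [Bool.or_assoc, ← Bool.decide_or]
        congr 2
        apply propext
        have h₁ := subset_fire A I
        have h₂ := subset_foldl_fire l (fire A I)
        constructor
        · rintro (h | h) h'
          · exact h (subset_antisymm (h₂.trans h'.subset) h₁)
          · exact h (subset_antisymm (h'.subset.trans h₁) h₂)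
        · intro h
          by_cases h' : fire A I = A
          · exact .inr (by rwa [h'] at h ⊢)
          · exact .inl h'
      refine ⟨c', ?_⟩
      have hrev : (encodeBasis es (I :: l)).reverse ++ q' = (encodeBasis es l).reverse ++
          ((encodeSet es I.1 ++ encodeSet es I.2).reverse ++ q') := by
        rw [← hc, List.reverse_append, List.append_assoc]
      rw [ha, List.foldl_cons, ← hg, hrev]
      exact this
  obtain ⟨c', hm⟩ := main l hl A c false []
  have hr := exec_restoreInner none c' ⟨false, decide (l.foldl fire A ≠ A), ch, one, two⟩
    p p' [] (encodeBasis es l).reverse (cells es T U (l.foldl fire A)) [] o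
  simp only [Bool.false_or, List.append_nil] at hm
  simp only [List.reverse_reverse, List.append_nil, List.length_reverse,
    length_encodeBasis] at hr
  refine (Exec.seq (exec_block ?_ ?_) (Exec.seq hm hr)).mono ?_
  · rfl
  · rintro (_ | _) <;> rfl
  -- With `m` implications over `n` elements: the loop takes `m(8n+13)+1` steps, restoring `2m(n+1)`
  -- symbols takes `4m(n+1)+2`, the first block takes one.
  · ring_nf; omega

theorem foldl_fire_subset {l : List (Finset S × Finset S)} {A X : Finset S} (hA : A ⊆ X)
    (hX : ∀ I ∈ l, I.1 ⊆ X → I.2 ⊆ X) : l.foldl fire A ⊆ X := by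
  induction l generalizing A with
  | nil => exact hA
  | cons I l ih =>
    refine ih ?_ fun J hJ => hX J (by simp [hJ])
    unfold fire
    split_ifs with h
    · exact Finset.union_subset hA (hX I (by simp) (h.trans hA))
    · exact hA

/-- Firing never removes elements, so a pass without net effect had no effect at any implication. -/
theorem subset_of_foldl_fire_eq {l : List (Finset S × Finset S)} {A : Finset S}
    (h : l.foldl fire A = A) : ∀ I ∈ l, I.1 ⊆ A → I.2 ⊆ A := by
  induction l with
  | nil => simp
  | cons I l ih =>
    have hI : fire A I = A :=
      subset_antisymm ((subset_foldl_fire l _).trans h.subset) (subset_fire A I)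
    rw [List.foldl_cons, hI] at h
    intro J hJ hJA
    rcases List.mem_cons.1 hJ with rfl | hJ
    · rw [fire, if_pos hJA] at hI
      exact Finset.union_eq_left.1 hI
    · exact ih h J hJ hJA

/-- The implications in `l` determine the closure operator `φ`. -/
def Determines (l : List (Finset S × Finset S)) (φ : ClosureOperator (Finset S)) : Prop :=
  ∀ A, φ.IsClosed A ↔ ∀ I ∈ l, I.1 ⊆ A → I.2 ⊆ A

/-- Replace the third set in the vector by its closure. -/
def closure : P :=
  .seq (.block [.load (Reg.mapFlags fun f => { f with grown := true })])
    (.loop (fun v => v.flags.grown) innerRound)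

/-- A bound on the number of steps of `closure`. -/
def closureTime (n m : ℕ) : ℕ := (n + 1) * (17 * (m * (n + 1)) + 5) + 2

theorem exec_closure {es : List S} {l : List (Finset S × Finset S)} (hl : Covers es l)
    {φ : ClosureOperator (Finset S)} (hφ : Determines l φ)
    (T U A : Finset S) (s : Option (Option Bool)) (c : Option Cell)
    (ch one two : Bool) (p p' : List (Option Bool)) (o : List Bool) :
    Exec closure ⟨s, c, ⟨false, false, ch, one, two⟩⟩
      (stk p p' (encodeBasis es l) [] (cells es T U A) [] o)
      ⟨none, none, ⟨false, false, ch, one, two⟩⟩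
      (stk p p' (encodeBasis es l) [] (cells es T U (φ A)) [] o)
      (closureTime es.length l.length) := by
  -- Here `k` bounds the number of enumerated elements outside `A`; every pass that changes `A`
  -- lowers it, and one last pass detects stability.
  have main : ∀ (k : ℕ) (A : Finset S) (s : Option (Option Bool)) (c : Option Cell),
      (es.toFinset \ A).card ≤ k →
      Exec (.loop (fun v => v.flags.grown) innerRound) ⟨s, c, ⟨false, true, ch, one, two⟩⟩
      (stk p p' (encodeBasis es l) [] (cells es T U A) [] o)
      ⟨none, none, ⟨false, false, ch, one, two⟩⟩
      (stk p p' (encodeBasis es l) [] (cells es T U (φ A)) [] o)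
      ((k + 1) * (17 * (l.length * (es.length + 1)) + 5) + 1) := by
    intro k
    induction k with
    | zero =>
      intro A s c hk
      have hr := exec_innerRound hl T U A s c true ch one two p p' o
      have hA : l.foldl fire A = A := by
        refine subset_antisymm (foldl_fire_subset subset_rfl fun I hI _ => ?_)
          (subset_foldl_fire l A)
        rw [Nat.le_zero, Finset.card_eq_zero, Finset.sdiff_eq_empty_iff_subset] at hk
        exact (hl I hI).2.trans hk
      have hcl : φ A = A := ((hφ A).2 (subset_of_foldl_fire_eq hA)).closure_eq
      simp only [hA, ne_eq, not_true_eq_false, decide_false] at hr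
      rw [hcl]
      exact (Exec.loop_true rfl hr (.loop_false rfl)).mono (by omega)
    | succ k ih =>
      intro A s c hk
      have hr := exec_innerRound hl T U A s c true ch one two p p' o
      by_cases hA : l.foldl fire A = A
      · have hcl : φ A = A := ((hφ A).2 (subset_of_foldl_fire_eq hA)).closure_eq
        simp only [hA, ne_eq, not_true_eq_false, decide_false] at hr
        rw [hcl]
        refine (Exec.loop_true rfl hr (.loop_false rfl)).mono ?_
        have := Nat.le_mul_of_pos_left (17 * (l.length * (es.length + 1)) + 5)
          (show 0 < k + 1 + 1 by omega)
        omega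
      · have hsub := subset_foldl_fire l A
        have hcl : φ (l.foldl fire A) = φ A := by
          refine le_antisymm ?_ (φ.monotone hsub)
          rw [φ.le_closure_iff.symm]
          exact foldl_fire_subset (φ.le_closure A) ((hφ _).1 (φ.isClosed_closure A))
        -- New elements come from conclusions, hence from `es`; this makes the measure drop
        -- strictly.
        have hes : l.foldl fire A ⊆ A ∪ es.toFinset := by
          refine foldl_fire_subset Finset.subset_union_left fun I hI _ => ?_
          exact (hl I hI).2.trans Finset.subset_union_right
        have hlt : (es.toFinset \ l.foldl fire A).card < (es.toFinset \ A).card := by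
          refine Finset.card_lt_card ((Finset.sdiff_subset_sdiff subset_rfl hsub).ssubset_of_ne ?_)
          intro h
          refine hA (subset_antisymm (fun x hx => ?_) hsub)
          by_contra hxA
          have : x ∈ es.toFinset \ A :=
            Finset.mem_sdiff.2 ⟨(Finset.mem_union.1 (hes hx)).resolve_left hxA, hxA⟩
          rw [← h] at this
          exact (Finset.mem_sdiff.1 this).2 hx
        have h' := ih (l.foldl fire A) none none (by omega)
        simp only [hA, ne_eq, not_false_eq_true, decide_true] at hr
        rw [hcl] at h'
        refine (Exec.loop_true rfl hr h').mono ?_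
        ring_nf; omega
  have hk : (es.toFinset \ A).card ≤ es.length :=
    (Finset.card_le_card Finset.sdiff_subset).trans es.toFinset_card_le
  refine (Exec.seq (exec_block ?_ ?_) (main es.length A s c hk)).mono ?_
  · rfl
  · rintro (_ | _) <;> rfl
  · unfold closureTime; omega

/-! #### One round of the main loop -/

/-- Remove from `U` the elements that the implication `I` excludes, given `T`. -/
def cut (φ : ClosureOperator (Finset S)) (T U : Finset S) (I : Finset S × Finset S) : Finset S :=
  if 2 ≤ I.1.card then U \ (I.2 \ φ (I.1 ∩ T)) else U

/-- Treat the next implication of the outer list. -/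
def outerStep : P :=
  .seq (outerSweep (fun _ b c => (c.1, c.2.1, b && c.1))
      fun f b _ => { f with one := f.one || b, two := f.two || (f.one && b) })
    (.seq rewind
    (.seq closure
    (.seq (outerSweep (fun f b c => (c.1, c.2.1 && !(f.two && (b && !c.2.2)), false))
      fun f _ _ => f)
    (.seq rewind
    (.block [.load (Reg.mapFlags fun f => { f with one := false, two := false }),
      .peek .outer Reg.setSym])))))

theorem exec_outerStep {es : List S} (hes : es.Nodup) {l : List (Finset S × Finset S)}
    (hl : Covers es l) {φ : ClosureOperator (Finset S)} (hφ : Determines l φ)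
    {I : Finset S × Finset S} (hI : I ∈ l) (T U A : Finset S)
    (s : Option (Option Bool)) (c : Option Cell) (ch : Bool)
    (p p' : List (Option Bool)) (o : List Bool) :
    Exec outerStep ⟨s, c, ⟨false, false, ch, false, false⟩⟩
      (stk (encodeSet es I.1 ++ encodeSet es I.2 ++ p) p' (encodeBasis es l) []
        (cells es T U A) [] o)
      ⟨p.head?, none, ⟨false, false, ch, false, false⟩⟩
      (stk p ((encodeSet es I.1 ++ encodeSet es I.2).reverse ++ p') (encodeBasis es l) []
        (cells es T (cut φ T U I) ∅) [] o)
      (closureTime es.length l.length + 8 * es.length + 11) := by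
  have load := exec_outerSweep (fun _ b c => (c.1, c.2.1, b && c.1))
    (fun f b _ => { f with one := f.one || b, two := f.two || (f.one && b) }) (fun _ _ _ => rfl)
    (fun e => decide (e ∈ I.1)) (fun e => (decide (e ∈ T), decide (e ∈ U), decide (e ∈ A))) es
    ⟨s, c, ⟨false, false, ch, false, false⟩⟩ (encodeSet es I.2 ++ p) p' (encodeBasis es l) [] o
  have hcount := foldl_count es (fun e => decide (e ∈ I.1)) false false ch 0
  simp only [zero_add, countP_mem_eq_card hes (hl I hI).1] at hcount
  have hmap : (es.map fun e => (decide (e ∈ T), decide (e ∈ U),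
      decide (e ∈ I.1) && decide (e ∈ T))) = cells es T U (I.1 ∩ T) :=
    List.map_congr_left fun e _ => by simp
  simp only [hmap] at load
  erw [hcount] at load
  -- From here on only `two` matters; `one` has served its purpose in the count.
  generalize decide (1 ≤ I.1.card) = one at load
  have rew := exec_rewind none none ⟨false, false, ch, one, decide (2 ≤ I.1.card)⟩
    (encodeSet es I.2 ++ p) (none :: (es.map fun e => some (decide (e ∈ I.1))).reverse ++ p')
    (encodeBasis es l) [] [] (cells es T U (I.1 ∩ T)).reverse o
  have clo := exec_closure hl hφ T U (I.1 ∩ T) none none ch one (decide (2 ≤ I.1.card))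
    (encodeSet es I.2 ++ p) (none :: (es.map fun e => some (decide (e ∈ I.1))).reverse ++ p') o
  have cutting := exec_outerSweep (fun f b c => (c.1, c.2.1 && !(f.two && (b && !c.2.2)), false))
    (fun f _ _ => f) (fun _ _ _ => rfl)
    (fun e => decide (e ∈ I.2))
    (fun e => (decide (e ∈ T), decide (e ∈ U), decide (e ∈ φ (I.1 ∩ T)))) es
    ⟨none, none, ⟨false, false, ch, one, decide (2 ≤ I.1.card)⟩⟩ p
    (none :: (es.map fun e => some (decide (e ∈ I.1))).reverse ++ p') (encodeBasis es l) [] o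
  have hmap' : (es.map fun e => (decide (e ∈ T), decide (e ∈ U) &&
      !(decide (2 ≤ I.1.card) && (decide (e ∈ I.2) && !decide (e ∈ φ (I.1 ∩ T)))), false)) =
      cells es T (cut φ T U I) ∅ := by
    refine List.map_congr_left fun e _ => ?_
    by_cases h : 2 ≤ I.1.card <;> simp [cut, h]
  have hid : es.foldl (fun f _ => f) (⟨false, false, ch, one, decide (2 ≤ I.1.card)⟩ : Flags) =
      ⟨false, false, ch, one, decide (2 ≤ I.1.card)⟩ := by simp
  simp only [hmap', hid] at cutting
  have rew' := exec_rewind none none ⟨false, false, ch, one, decide (2 ≤ I.1.card)⟩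
    p (none :: (es.map fun e => some (decide (e ∈ I.2))).reverse ++
      (none :: (es.map fun e => some (decide (e ∈ I.1))).reverse ++ p'))
    (encodeBasis es l) [] [] (cells es T (cut φ T U I) ∅).reverse o
  simp only [List.reverse_reverse, List.append_nil, List.length_reverse] at rew rew'
  have hp : encodeSet es I.1 ++ encodeSet es I.2 ++ p =
      es.map (fun e => some (decide (e ∈ I.1))) ++ none :: (encodeSet es I.2 ++ p) := by
    simp [encodeSet]
  have hp' : encodeSet es I.2 ++ p = es.map (fun e => some (decide (e ∈ I.2))) ++ none :: p := by
    simp [encodeSet]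
  have hr : (encodeSet es I.1 ++ encodeSet es I.2).reverse ++ p' =
      none :: (es.map fun e => some (decide (e ∈ I.2))).reverse ++
      (none :: (es.map fun e => some (decide (e ∈ I.1))).reverse ++ p') := by
    simp [encodeSet]
  have len : (cells es T U (I.1 ∩ T)).length = es.length := by simp [cells]
  have len' : (cells es T (cut φ T U I) ∅).length = es.length := by simp [cells]
  rw [hp, hr]
  rw [hp'] at load rew clo ⊢
  refine (Exec.seq load (Exec.seq rew (Exec.seq clo (Exec.seq cutting
    (Exec.seq rew' (exec_block ?_ ?_)))))).mono ?_
  · rfl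
  · rintro (_ | _) <;> rfl
  · omega

/-- Replace `T` by `U` and `U` by the full set. -/
def commit : P :=
  .seq (.block [.pop .vec Reg.setCell])
    (.seq (.loop Reg.hasCell (.block [.push .vecPassed fun v => (v.getCell.2.1, true, false),
      .load fun v => v.mapFlags fun f =>
        { f with changed := f.changed || (v.getCell.2.1 && !v.getCell.1) },
      .pop .vec Reg.setCell])) rewind)

theorem exec_commit [Fintype S] (es : List S) (T U : Finset S) (f : Flags)
    (p p' q q' : List (Option Bool)) (o : List Bool) :
    Exec commit ⟨none, none, f⟩ (stk p p' q q' (cells es T U ∅) [] o)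
      ⟨none, none, { f with
        changed := f.changed || es.any fun e => decide (e ∈ U) && !decide (e ∈ T) }⟩
      (stk p p' q q' (cells es U Finset.univ ∅) [] o) (4 * es.length + 4) := by
  have main : ∀ (es : List S) (f : Flags) (w' : List Cell), Exec (.loop Reg.hasCell
      (.block [.push .vecPassed fun v => (v.getCell.2.1, true, false),
      .load fun v => v.mapFlags fun f =>
        { f with changed := f.changed || (v.getCell.2.1 && !v.getCell.1) },
      .pop .vec Reg.setCell]))
      (⟨none, (cells es T U ∅).head?, f⟩ : Reg) (stk p p' q q' (cells es T U ∅).tail w' o)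
      ⟨none, none, es.foldl (fun f e =>
        { f with changed := f.changed || (decide (e ∈ U) && !decide (e ∈ T)) }) f⟩
      (stk p p' q q' [] ((cells es U Finset.univ ∅).reverse ++ w') o) (2 * es.length + 1) := by
    intro es
    induction es with
    | nil => exact fun f w' => .loop_false rfl
    | cons e es ih =>
      intro f w'
      have := (Exec.loop_true
        (v := ⟨none, some (decide (e ∈ T), decide (e ∈ U), decide (e ∈ (∅ : Finset S))), f⟩)
        (S := stk p p' q q' (cells es T U ∅) w' o) rfl
        (exec_block rfl (by rintro (_ | _) <;> rfl))
        (ih { f with changed := f.changed || (decide (e ∈ U) && !decide (e ∈ T)) }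
          ((decide (e ∈ U), true, false) :: w'))).mono
        (t' := 2 * (es.length + 1) + 1) (by omega)
      simpa [cells] using this
  have hm := main es f []
  rw [foldl_changed es (fun e => decide (e ∈ U) && !decide (e ∈ T)), List.append_nil] at hm
  have rew := exec_rewind none none { f with
    changed := f.changed || es.any fun e => decide (e ∈ U) && !decide (e ∈ T) } p p' q q' []
    (cells es U Finset.univ ∅).reverse o
  simp only [List.reverse_reverse, List.append_nil, List.length_reverse] at rew
  have len : (cells es U Finset.univ ∅).length = es.length := by simp [cells]
  refine (Exec.seq (exec_block ?_ ?_) (Exec.seq hm rew)).mono ?_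
  · rfl
  · rintro (_ | _) <;> rfl
  · omega

/-- Replace `T` by the elements that no implication excludes. -/
def round : P :=
  .seq (.block [.load (Reg.mapFlags fun f => { f with changed := false }),
      .peek .outer Reg.setSym])
    (.seq (.loop Reg.hasSym outerStep) (.seq restoreOuter commit))

/-- A bound on the number of steps of `round`. -/
def roundTime (n m : ℕ) : ℕ :=
  m * (closureTime n m + 8 * n + 12) + 4 * (m * (n + 1)) + 4 * n + 8

/-- The elements that no implication in `l` excludes, given `T`. -/
def next [Fintype S] (φ : ClosureOperator (Finset S)) (l : List (Finset S × Finset S))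
    (T : Finset S) : Finset S :=
  l.foldl (cut φ T) Finset.univ

theorem exec_round [Fintype S] {es : List S} (hes : es.Nodup) {l : List (Finset S × Finset S)}
    (hl : Covers es l) {φ : ClosureOperator (Finset S)} (hφ : Determines l φ) (T : Finset S)
    (s : Option (Option Bool)) (c : Option Cell) (ch : Bool) (o : List Bool) :
    Exec round ⟨s, c, ⟨false, false, ch, false, false⟩⟩
      (stk (encodeBasis es l) [] (encodeBasis es l) [] (cells es T Finset.univ ∅) [] o)
      ⟨none, none, ⟨false, false, es.any fun e => decide (e ∈ next φ l T) && !decide (e ∈ T),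
        false, false⟩⟩
      (stk (encodeBasis es l) [] (encodeBasis es l) [] (cells es (next φ l T) Finset.univ ∅) [] o)
      (roundTime es.length l.length) := by
  -- The outer list shrinks to the unread part `r`, while the inner list keeps all of `l`, since the
  -- closures need every implication.
  have main : ∀ (r : List (Finset S × Finset S)), r ⊆ l → ∀ (U : Finset S)
      (c : Option Cell) (p' : List (Option Bool)), ∃ c',
      Exec (.loop Reg.hasSym outerStep)
      ⟨(encodeBasis es r).head?, c, ⟨false, false, false, false, false⟩⟩
      (stk (encodeBasis es r) p' (encodeBasis es l) [] (cells es T U ∅) [] o)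
      ⟨none, c', ⟨false, false, false, false, false⟩⟩
      (stk [] ((encodeBasis es r).reverse ++ p') (encodeBasis es l) []
        (cells es T (r.foldl (cut φ T) U) ∅) [] o)
      (r.length * (closureTime es.length l.length + 8 * es.length + 12) + 1) := by
    intro r
    induction r with
    | nil =>
      intro _ U c p'
      simp only [encodeBasis, List.flatMap_nil, List.head?_nil, List.foldl_nil,
        List.reverse_nil, List.nil_append]
      exact ⟨c, (Exec.loop_false rfl).mono (by omega)⟩
    | cons I r ih =>
      intro hr U c p'
      obtain ⟨c', h'⟩ := ih (fun J hJ => hr (by simp [hJ])) (cut φ T U I) none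
        ((encodeSet es I.1 ++ encodeSet es I.2).reverse ++ p')
      obtain ⟨a, ha⟩ := head?_encodeBasis_cons es I r
      have hs := exec_outerStep hes hl hφ (hr (List.mem_cons_self ..)) T U ∅ (some a) c false
        (encodeBasis es r) p' o
      have hc : encodeSet es I.1 ++ encodeSet es I.2 ++ encodeBasis es r =
          encodeBasis es (I :: r) := rfl
      rw [hc] at hs
      have := (Exec.loop_true rfl hs h').mono
        (t' := (r.length + 1) * (closureTime es.length l.length + 8 * es.length + 12) + 1)
        (by ring_nf; omega)
      have hrev : (encodeBasis es (I :: r)).reverse ++ p' = (encodeBasis es r).reverse ++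
          ((encodeSet es I.1 ++ encodeSet es I.2).reverse ++ p') := by
        rw [← hc, List.reverse_append, List.append_assoc]
      refine ⟨c', ?_⟩
      rw [ha, List.foldl_cons, hrev]
      exact this
  obtain ⟨c', hm⟩ := main l (List.Subset.refl l) Finset.univ c []
  have hr := exec_restoreOuter none c' ⟨false, false, false, false, false⟩
    [] (encodeBasis es l).reverse (encodeBasis es l) [] (cells es T (next φ l T) ∅) [] o
  have hc := exec_commit es T (next φ l T) ⟨false, false, false, false, false⟩ (encodeBasis es l) []
    (encodeBasis es l) [] o
  simp only [List.append_nil] at hm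
  simp only [List.reverse_reverse, List.append_nil, List.length_reverse,
    length_encodeBasis] at hr
  simp only [Bool.false_or] at hc
  refine (Exec.seq (exec_block ?_ ?_) (Exec.seq hm (Exec.seq hr hc))).mono ?_
  · rfl
  · rintro (_ | _) <;> rfl
  · unfold roundTime; omega

/-- Repeat `round` until it changes nothing. -/
def rounds : P :=
  .seq (.block [.load (Reg.mapFlags fun f => { f with changed := true })])
    (.loop (fun v => v.flags.changed) round)

theorem any_mem_and_notMem_eq_false {es : List S} {U T : Finset S}
    (h : ∀ e ∈ es, e ∈ U → e ∈ T) :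
    (es.any fun e => decide (e ∈ U) && !decide (e ∈ T)) = false := by
  simpa using h

theorem any_mem_and_notMem_eq_true {es : List S} {U T : Finset S}
    (h : ¬ ∀ e ∈ es, e ∈ U → e ∈ T) :
    (es.any fun e => decide (e ∈ U) && !decide (e ∈ T)) = true := by
  simpa using h

/-- The iterates increase, so a round that sets `changed` adds an enumerated element. The result
carries index `k + 1` because the last round confirms that nothing new has entered. -/
theorem exec_rounds [Fintype S] {es : List S} (hes : es.Nodup) {l : List (Finset S × Finset S)}
    (hl : Covers es l) {φ : ClosureOperator (Finset S)} (hφ : Determines l φ)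
    (hmono : ∀ k, (next φ l)^[k] ∅ ⊆ (next φ l)^[k + 1] ∅) :
    ∃ k, (∀ e ∈ es, e ∈ (next φ l)^[k + 1] ∅ → e ∈ (next φ l)^[k] ∅) ∧
    Exec rounds ⟨none, none, ⟨false, false, false, false, false⟩⟩
      (stk (encodeBasis es l) [] (encodeBasis es l) [] (cells es ∅ Finset.univ ∅) [] [])
      ⟨none, none, ⟨false, false, false, false, false⟩⟩
      (stk (encodeBasis es l) [] (encodeBasis es l) []
        (cells es ((next φ l)^[k + 1] ∅) Finset.univ ∅) [] [])
      ((es.length + 1) * (roundTime es.length l.length + 1) + 2) := by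
  have main : ∀ (n k : ℕ), (es.toFinset \ (next φ l)^[k] ∅).card ≤ n →
      ∃ k', (∀ e ∈ es, e ∈ (next φ l)^[k' + 1] ∅ → e ∈ (next φ l)^[k'] ∅) ∧
      Exec (.loop (fun v => v.flags.changed) round) ⟨none, none, ⟨false, false, true, false, false⟩⟩
      (stk (encodeBasis es l) [] (encodeBasis es l) []
        (cells es ((next φ l)^[k] ∅) Finset.univ ∅) [] [])
      ⟨none, none, ⟨false, false, false, false, false⟩⟩
      (stk (encodeBasis es l) [] (encodeBasis es l) []
        (cells es ((next φ l)^[k' + 1] ∅) Finset.univ ∅) [] [])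
      ((n + 1) * (roundTime es.length l.length + 1) + 1) := by
    intro n
    induction n with
    | zero =>
      intro k hk
      rw [Nat.le_zero, Finset.card_eq_zero, Finset.sdiff_eq_empty_iff_subset] at hk
      have hr := exec_round hes hl hφ ((next φ l)^[k] ∅) none none true []
      rw [← Function.iterate_succ_apply' (next φ l)] at hr
      rw [any_mem_and_notMem_eq_false fun e he _ => hk (List.mem_toFinset.2 he)] at hr
      exact ⟨k, fun e he _ => hk (List.mem_toFinset.2 he),
        (Exec.loop_true rfl hr (.loop_false rfl)).mono (by omega)⟩
    | succ n ih =>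
      intro k hk
      have hr := exec_round hes hl hφ ((next φ l)^[k] ∅) none none true []
      rw [← Function.iterate_succ_apply' (next φ l)] at hr
      by_cases hfix : ∀ e ∈ es, e ∈ (next φ l)^[k + 1] ∅ → e ∈ (next φ l)^[k] ∅
      · rw [any_mem_and_notMem_eq_false hfix] at hr
        refine ⟨k, hfix, (Exec.loop_true rfl hr (.loop_false rfl)).mono ?_⟩
        have := Nat.le_mul_of_pos_left (roundTime es.length l.length + 1)
          (show 0 < n + 1 + 1 by omega)
        omega
      · rw [any_mem_and_notMem_eq_true hfix] at hr
        have hlt : (es.toFinset \ (next φ l)^[k + 1] ∅).card <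
            (es.toFinset \ (next φ l)^[k] ∅).card := by
          refine Finset.card_lt_card
            ((Finset.sdiff_subset_sdiff subset_rfl (hmono k)).ssubset_of_ne fun h => hfix ?_)
          intro e he hek
          by_contra hne
          have : e ∈ es.toFinset \ (next φ l)^[k] ∅ :=
            Finset.mem_sdiff.2 ⟨List.mem_toFinset.2 he, hne⟩
          rw [← h] at this
          exact (Finset.mem_sdiff.1 this).2 hek
        obtain ⟨k', hk', h'⟩ := ih (k + 1) (by omega)
        refine ⟨k', hk', (Exec.loop_true rfl hr h').mono ?_⟩
        ring_nf; omega
  have hn : (es.toFinset \ (next φ l)^[0] ∅).card ≤ es.length :=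
    (Finset.card_le_card Finset.sdiff_subset).trans es.toFinset_card_le
  obtain ⟨k, hk, h⟩ := main es.length 0 hn
  refine ⟨k, hk, (Exec.seq (exec_block ?_ ?_) h).mono ?_⟩
  · rfl
  · rintro (_ | _) <;> rfl
  · omega

/-! #### The whole program -/

/-- Copy the input to the inner list and write the first vector. -/
def start : P :=
  .seq (.block [.pop .outer Reg.setSym])
    (.seq (.loop Reg.isBit (.block [.push .outerPassed Reg.getSym,
      .push .vec fun _ => (false, true, false), .pop .outer Reg.setSym]))
    (.seq (.loop Reg.hasSym (.block [.push .outerPassed Reg.getSym, .pop .outer Reg.setSym]))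
    (.seq (.block [.pop .outerPassed Reg.setSym])
    (.loop Reg.hasSym (.block [.push .outer Reg.getSym, .push .inner Reg.getSym,
      .pop .outerPassed Reg.setSym])))))

/-- The machine learns the number of elements from the first vector, by writing one cell per bit. By
`hr` this vector is followed by a separator or by the end of the word. -/
theorem exec_start (f : Flags) (bs : List Bool) (r : List (Option Bool))
    (hr : r.head?.join = none) :
    Exec start ⟨none, none, f⟩ (stk (bs.map some ++ r) [] [] [] [] [] [])
      ⟨none, none, f⟩ (stk (bs.map some ++ r) [] (bs.map some ++ r) []
        (List.replicate bs.length (false, true, false)) [] []) (6 * bs.length + 4 * r.length + 5) := by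
  have bits : ∀ (bs : List Bool) (p' : List (Option Bool)) (w : List Cell),
      Exec (.loop Reg.isBit (.block [.push .outerPassed Reg.getSym,
        .push .vec fun _ => (false, true, false), .pop .outer Reg.setSym]))
      (⟨(bs.map some ++ r).head?, none, f⟩ : Reg) (stk (bs.map some ++ r).tail p' [] [] w [] [])
      ⟨r.head?, none, f⟩ (stk r.tail ((bs.map some).reverse ++ p') [] []
        (List.replicate bs.length (false, true, false) ++ w) [] []) (2 * bs.length + 1) := by
    intro bs
    induction bs with
    | nil => exact fun p' w => .loop_false (by simp [Reg.isBit, hr])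
    | cons b bs ih =>
      intro p' w
      have := (Exec.loop_true (v := ⟨some (some b), none, f⟩)
        (S := stk (bs.map some ++ r) p' [] [] w [] []) rfl
        (exec_block rfl (by rintro (_ | _) <;> rfl))
        (ih (some b :: p') ((false, true, false) :: w))).mono
        (t' := 2 * (bs.length + 1) + 1) (by omega)
      simpa [List.replicate_succ', List.append_assoc] using this
  have rest : ∀ (r p' : List (Option Bool)) (w : List Cell),
      Exec (.loop Reg.hasSym (.block [.push .outerPassed Reg.getSym, .pop .outer Reg.setSym]))
      (⟨r.head?, none, f⟩ : Reg) (stk r.tail p' [] [] w [] [])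
      ⟨none, none, f⟩ (stk [] (r.reverse ++ p') [] [] w [] []) (2 * r.length + 1) := by
    intro r
    induction r with
    | nil => exact fun p' w => .loop_false rfl
    | cons a r ih =>
      intro p' w
      have := (Exec.loop_true (v := ⟨some a, none, f⟩) (S := stk r p' [] [] w [] []) rfl
        (exec_block rfl (by rintro (_ | _) <;> rfl)) (ih (a :: p') w)).mono
        (t' := 2 * (r.length + 1) + 1) (by omega)
      simpa using this
  have back : ∀ (p' p : List (Option Bool)) (w : List Cell),
      Exec (.loop Reg.hasSym (.block [.push .outer Reg.getSym, .push .inner Reg.getSym,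
        .pop .outerPassed Reg.setSym]))
      (⟨p'.head?, none, f⟩ : Reg) (stk p p'.tail p [] w [] [])
      ⟨none, none, f⟩ (stk (p'.reverse ++ p) [] (p'.reverse ++ p) [] w [] [])
      (2 * p'.length + 1) := by
    intro p'
    induction p' with
    | nil => exact fun p' w => .loop_false rfl
    | cons a p' ih =>
      intro p w
      have := (Exec.loop_true (v := ⟨some a, none, f⟩) (S := stk p p' p [] w [] []) rfl
        (exec_block rfl (by rintro (_ | _) <;> rfl)) (ih (a :: p) w)).mono
        (t' := 2 * (p'.length + 1) + 1) (by omega)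
      simpa using this
  have h₁ := bits bs [] []
  have h₂ := rest r ((bs.map some).reverse ++ [])
    (List.replicate bs.length (false, true, false) ++ [])
  have h₃ := back (r.reverse ++ ((bs.map some).reverse ++ [])) []
    (List.replicate bs.length (false, true, false) ++ [])
  simp only [List.append_nil, List.reverse_append, List.reverse_reverse] at h₁ h₂ h₃
  refine (Exec.seq (exec_block ?_ ?_) (Exec.seq h₁ (Exec.seq h₂
    (Exec.seq (exec_block ?_ ?_) h₃)))).mono ?_
  · rfl
  · rintro (_ | _) <;> rfl
  · rfl
  · rintro (_ | _) <;> rfl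
  · simp; omega

/-- The register at the beginning and at the end. -/
def Reg.initial : Reg := ⟨none, none, ⟨false, false, false, false, false⟩⟩

/-- Empty the stacks and write whether all elements lie in `T`. -/
def verdict : P :=
  .seq (.block [.load (Reg.mapFlags fun f => { f with ok := true }), .pop .vec Reg.setCell])
    (.seq (.loop Reg.hasCell (.block [.load fun v => v.mapFlags fun f =>
      { f with ok := f.ok && v.getCell.1 }, .pop .vec Reg.setCell]))
    (.seq (.block [.pop .outer Reg.setSym])
    (.seq (.loop Reg.hasSym (.block [.pop .outer Reg.setSym]))
    (.seq (.block [.pop .inner Reg.setSym])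
    (.seq (.loop Reg.hasSym (.block [.pop .inner Reg.setSym]))
    (.block [.push .out fun v => v.flags.ok, .load fun _ => Reg.initial]))))))

/-- A halting configuration in the sense of `Turing.haltList` has the initial register and nothing
but the output on its stacks, hence the cleaning up. -/
theorem exec_verdict (es : List S) (T U A : Finset S) (p q : List (Option Bool)) :
    Exec verdict Reg.initial (stk p [] q [] (cells es T U A) [] [])
      Reg.initial (stk [] [] [] [] [] [] [es.all fun e => decide (e ∈ T)])
      (2 * es.length + 2 * p.length + 2 * q.length + 7) := by
  have all : ∀ (es : List S) (f : Flags), Exec (.loop Reg.hasCell (.block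
      [.load fun v => v.mapFlags fun f => { f with ok := f.ok && v.getCell.1 },
        .pop .vec Reg.setCell]))
      (⟨none, (cells es T U A).head?, f⟩ : Reg) (stk p [] q [] (cells es T U A).tail [] [])
      ⟨none, none, es.foldl (fun f e => { f with ok := f.ok && decide (e ∈ T) }) f⟩
      (stk p [] q [] [] [] []) (2 * es.length + 1) := by
    intro es
    induction es with
    | nil => exact fun f => .loop_false rfl
    | cons e es ih =>
      intro f
      exact (Exec.loop_true
        (v := ⟨none, some (decide (e ∈ T), decide (e ∈ U), decide (e ∈ A)), f⟩)
        (S := stk p [] q [] (cells es T U A) [] []) rfl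
        (exec_block rfl (by rintro (_ | _) <;> rfl))
        (ih { f with ok := f.ok && decide (e ∈ T) })).mono
        (t' := 2 * (es.length + 1) + 1) (by omega)
  have outer : ∀ (f : Flags) (p : List (Option Bool)), Exec (.loop Reg.hasSym
      (.block [.pop .outer Reg.setSym]))
      (⟨p.head?, none, f⟩ : Reg) (stk p.tail [] q [] [] [] []) ⟨none, none, f⟩
      (stk [] [] q [] [] [] []) (2 * p.length + 1) := by
    intro f p
    induction p with
    | nil => exact .loop_false rfl
    | cons a p ih =>
      exact (Exec.loop_true (v := ⟨some a, none, f⟩) (S := stk p [] q [] [] [] []) rfl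
        (exec_block rfl (by rintro (_ | _) <;> rfl)) ih).mono
        (t' := 2 * (p.length + 1) + 1) (by omega)
  have inner : ∀ (f : Flags) (q : List (Option Bool)), Exec (.loop Reg.hasSym
      (.block [.pop .inner Reg.setSym]))
      (⟨q.head?, none, f⟩ : Reg) (stk [] [] q.tail [] [] [] []) ⟨none, none, f⟩
      (stk [] [] [] [] [] [] []) (2 * q.length + 1) := by
    intro f q
    induction q with
    | nil => exact .loop_false rfl
    | cons a q ih =>
      exact (Exec.loop_true (v := ⟨some a, none, f⟩) (S := stk [] [] q [] [] [] []) rfl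
        (exec_block rfl (by rintro (_ | _) <;> rfl)) ih).mono
        (t' := 2 * (q.length + 1) + 1) (by omega)
  have h := all es ⟨true, false, false, false, false⟩
  rw [foldl_ok es (fun e => decide (e ∈ T))] at h
  simp only [Bool.true_and] at h
  have h' := outer ⟨es.all fun e => decide (e ∈ T), false, false, false, false⟩ p
  have h'' := inner ⟨es.all fun e => decide (e ∈ T), false, false, false, false⟩ q
  refine (Exec.seq (exec_block ?_ ?_) (Exec.seq h (Exec.seq (exec_block ?_ ?_) (Exec.seq
    h' (Exec.seq (exec_block ?_ ?_) (Exec.seq h'' (exec_block ?_ ?_))))))).mono ?_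
  all_goals first | rfl | (rintro (_ | _) <;> rfl) | omega

/-- The program of the machine. -/
def program : P := .seq start (.seq rounds verdict)

/-- A bound on the number of steps of the machine. -/
def programTime (n m : ℕ) : ℕ :=
  (n + 1) * (roundTime n m + 1) + 8 * n + 16 * (m * (n + 1)) + 14

theorem exec_program [Fintype S] {es : List S} (hes : es.Nodup)
    {l : List (Finset S × Finset S)} (hl : Covers es l) {φ : ClosureOperator (Finset S)}
    (hφ : Determines l φ) (hmono : ∀ k, (next φ l)^[k] ∅ ⊆ (next φ l)^[k + 1] ∅)
    (hempty : l = [] → es = []) :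
    ∃ k, (∀ e ∈ es, e ∈ (next φ l)^[k + 1] ∅ → e ∈ (next φ l)^[k] ∅) ∧
    Exec program Reg.initial (stk (encodeBasis es l) [] [] [] [] [] []) Reg.initial
      (stk [] [] [] [] [] [] [es.all fun e => decide (e ∈ (next φ l)^[k + 1] ∅)])
      (programTime es.length l.length) := by
  obtain ⟨k, hk, hr⟩ := exec_rounds hes hl hφ hmono
  refine ⟨k, hk, ?_⟩
  have hv := exec_verdict es ((next φ l)^[k + 1] ∅) Finset.univ ∅ (encodeBasis es l)
    (encodeBasis es l)
  -- The first premise supplies one bit per element. With no implications the word is empty and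
  -- shows no elements, which is why `hempty` is needed.
  obtain ⟨bs, r, hbs, hlen, hrj⟩ : ∃ (bs : List Bool) (r : List (Option Bool)),
      encodeBasis es l = bs.map some ++ r ∧ bs.length = es.length ∧ r.head?.join = none := by
    cases l with
    | nil => exact ⟨[], [], rfl, by simp [hempty rfl], rfl⟩
    | cons I l =>
      exact ⟨es.map fun e => decide (e ∈ I.1), none :: (encodeSet es I.2 ++ encodeBasis es l),
        by simp [encodeBasis, encodeSet, Function.comp_def], by simp, rfl⟩
  have hs := exec_start ⟨false, false, false, false, false⟩ bs r hrj
  have hcells : List.replicate bs.length (false, true, false) = cells es ∅ Finset.univ ∅ := by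
    rw [hlen]
    exact (List.eq_replicate_iff.2 ⟨by simp [cells], by simp [cells]⟩).symm
  have hlen' := congrArg List.length hbs
  rw [List.length_append, List.length_map, length_encodeBasis] at hlen'
  rw [← hbs, hcells] at hs
  rw [length_encodeBasis] at hv
  refine (Exec.seq hs (Exec.seq hr hv)).mono ?_
  unfold programTime
  omega

/-- The machine. -/
def machine : Turing.TM2ComputableAux (Option Bool) Bool where
  tm :=
    { K := Stack
      k₀ := .outer
      k₁ := .out
      Γ := Sym
      Λ := Label program
      main := entry program
      ΛFin := labelFintype program
      σ := Reg
      initialState := Reg.initial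
      Γk₀Fin := inferInstanceAs (Fintype (Option Bool))
      m := code program id .halt }
  inputAlphabet := Equiv.refl _
  outputAlphabet := Equiv.refl _

theorem machine_outputs {w : List (Option Bool)} {b : Bool} {t : ℕ}
    (h : Exec program Reg.initial (stk w [] [] [] [] [] []) Reg.initial
      (stk [] [] [] [] [] [] [b]) t) :
    Nonempty (Turing.TM2OutputsInTime machine.tm (w.map machine.inputAlphabet.invFun)
      (some ((Computability.encodeBool b).map machine.outputAlphabet.invFun)) t) := by
  have := h.reachesIn (code program id .halt) id .halt fun _ => rfl
  have hi : Turing.initList machine.tm (w.map machine.inputAlphabet.invFun) =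
      ⟨some (entry program), Reg.initial, stk w [] [] [] [] [] []⟩ := by
    have hw : w.map machine.inputAlphabet.invFun = w := List.map_id w
    rw [hw]
    unfold Turing.initList
    congr 1
    funext k
    cases k <;> rfl
  have ho : Turing.haltList machine.tm
      ((Computability.encodeBool b).map machine.outputAlphabet.invFun) =
      ⟨none, Reg.initial, stk [] [] [] [] [] [] [b]⟩ := by
    unfold Turing.haltList
    congr 1
    funext k
    cases k <;> rfl
  unfold Turing.TM2OutputsInTime
  rw [hi, Option.map_some, ho]
  exact this

end DCycleMachine

namespace ClosureSys

open DCycleMachine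

/-! ### Cycles, well-foundedness and down-sets. -/

section Criterion

variable {S : Type*} {φ : ClosureOperator (Finset S)}

theorem mem_closure_singleton (x : S) : x ∈ φ {x} :=
  φ.le_closure {x} (Finset.mem_singleton_self x)

theorem closure_subset_of_isClosed {A X : Finset S} (h : A ⊆ X) (hX : φ.IsClosed X) : φ A ⊆ X :=
  φ.closure_min h hX

theorem closure_singleton_subset {x : S} {A : Finset S} (h : x ∈ φ A) : φ {x} ⊆ φ A :=
  closure_subset_of_isClosed (Finset.singleton_subset_iff.2 h) (φ.isClosed_closure A)

theorem subset_closure (A : Finset S) : A ⊆ φ A := φ.le_closure A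

theorem closure_mono {A B : Finset S} (h : A ⊆ B) : φ A ⊆ φ B := φ.monotone h

/-- Covers are non-trivial, so `D` has no loops and the condition `n > 2` in the definition of a
cycle excludes nothing. -/
theorem DRel.ne {x y : S} (h : DRel φ x y) : x ≠ y := by
  rintro rfl
  obtain ⟨Z, ⟨⟨_, hnt⟩, _⟩, hy⟩ := h
  exact hnt x hy (mem_closure_singleton x)

theorem withoutDCycles_of_wellFounded (h : WellFounded fun b a => DRel φ a b) :
    WithoutDCycles φ := by
  rintro ⟨n, x, hn, hx, hxn⟩
  obtain ⟨m, ⟨i, hi, hin, rfl⟩, hm⟩ := h.has_min {a | ∃ i, 1 ≤ i ∧ i < n ∧ x i = a}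
    ⟨x 1, 1, le_rfl, by omega, rfl⟩
  rcases Nat.lt_or_ge (i + 1) n with hlt | hge
  · exact hm _ ⟨i + 1, by omega, hlt, rfl⟩ (hx i hi hin)
  -- The minimal value sits at index `n - 1`; its successor is `x n = x 1`, which is again among the
  -- values considered.
  · have hd := hx i hi hin
    rw [show i + 1 = n by omega, ← hxn] at hd
    exact hm _ ⟨1, le_rfl, by omega, rfl⟩ hd

theorem WithoutDCycles.wellFounded [Finite S] (h : WithoutDCycles φ) :
    WellFounded fun b a => DRel φ a b := by
  rw [wellFounded_iff_isEmpty_descending_chain]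
  refine ⟨fun ⟨f, hf⟩ => ?_⟩
  obtain ⟨i, j, hne, hij⟩ := Finite.exists_ne_map_eq_of_infinite f
  wlog hlt : i < j generalizing i j
  · exact this j i hne.symm hij.symm (by omega)
  -- Irreflexivity makes the repeated segment long enough for `n > 2`.
  have hj : i + 1 ≠ j := by
    rintro rfl
    exact (hf i).ne hij
  refine h ⟨j - i + 1, fun k => f (i + (k - 1)), by omega, fun k hk _ => ?_, ?_⟩
  · have := hf (i + (k - 1))
    rwa [show i + (k - 1) + 1 = i + (k + 1 - 1) by omega] at this
  · simp [hij, show i + (j - i) = j by omega]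

/-- Down-sets of the order `y ∈ φ {z}` on `S`. -/
def IsDown (φ : ClosureOperator (Finset S)) (W : Finset S) : Prop :=
  ∀ w ∈ W, φ {w} ⊆ W

variable [DecidableEq S]

/-- Otherwise `x` lies in the closed set `φ {y} \ {y}`, which then contains `φ {x}` and with it `y`.
-/
theorem IsStandard.antisymm (hφ : IsStandard φ) {x y : S} (h : x ∈ φ {y}) (h' : y ∈ φ {x}) :
    x = y := by
  by_contra hne
  have : x ∈ φ {y} \ {y} := by simp [h, hne]
  have := closure_subset_of_isClosed (Finset.singleton_subset_iff.2 this) (hφ.2 y) h'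
  simp at this

/-! ### The canonical basis -/

theorem IsQuasiClosed.exists_isCritical {Q : Finset S} (hQ : IsQuasiClosed φ Q) :
    ∃ C ⊆ Q, IsCritical φ C ∧ φ C = φ Q := by
  induction Q using Finset.strongInduction with
  | H Q ih =>
    by_cases h : IsCritical φ Q
    · exact ⟨Q, subset_rfl, h, rfl⟩
    · have : ∃ Q', Q' ⊆ Q ∧ IsQuasiClosed φ Q' ∧ φ Q' = φ Q ∧ Q' ≠ Q := by
        by_contra hne
        push Not at hne
        exact h ⟨hQ, hne⟩
      obtain ⟨Q', hQ', hqc, hcl, hne⟩ := this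
      obtain ⟨C, hC, hcrit, hCcl⟩ := ih Q' (hQ'.ssubset_of_ne hne) hqc
      exact ⟨C, hC.trans hQ', hcrit, hCcl.trans hcl⟩

/-- A set that is closed under the implications with critical premises is closed. -/
theorem isClosed_of_isCritical {A : Finset S}
    (hA : ∀ C, IsCritical φ C → C ⊆ A → φ C ⊆ A) : φ.IsClosed A := by
  by_contra hcl
  have hex : ∃ Q ∈ A.powerset, ¬ φ Q ⊆ A := by
    refine ⟨A, by simp, fun h => hcl ?_⟩
    exact φ.isClosed_iff_closure_le.2 h
  -- Among the subsets of `A` whose closure leaves `A`, take one with smallest closure. Then `A ∩ φ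
  -- Q` will be quasi-closed, and a critical set inside it with the same closure contradicts `hA`.
  obtain ⟨Q, hQ, hmin⟩ := Finset.exists_min_image (A.powerset.filter fun Q => ¬ φ Q ⊆ A)
    (fun Q => (φ Q).card) (by
      obtain ⟨Q, hQ, h⟩ := hex
      exact ⟨Q, Finset.mem_filter.2 ⟨hQ, h⟩⟩)
  simp only [Finset.mem_filter, Finset.mem_powerset, and_imp] at hQ hmin
  set R := A ∩ φ Q with hR
  have hQR : Q ⊆ R := Finset.subset_inter hQ.1 (subset_closure Q)
  have hRcl : φ R = φ Q :=
    subset_antisymm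
      (closure_subset_of_isClosed Finset.inter_subset_right (φ.isClosed_closure Q))
      (closure_mono hQR)
  have hqc : IsQuasiClosed φ R := by
    refine ⟨fun h => hQ.2 ?_, fun X hX hRX => ?_⟩
    · rw [← hRcl, h.closure_eq]
      exact Finset.inter_subset_left
    · have h₁ : φ (R ∩ X) ⊆ X := closure_subset_of_isClosed Finset.inter_subset_right hX
      have h₂ : φ (R ∩ X) ⊆ φ Q := hRcl ▸ closure_mono Finset.inter_subset_left
      have h₃ : φ (R ∩ X) ⊆ A := by
        -- If `φ (R ∩ X)` left `A`, minimality would make it equal to `φ Q`, so `R ⊆ φ Q ⊆ X`.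
        by_contra h
        have hle := hmin (R ∩ X) (Finset.inter_subset_left.trans Finset.inter_subset_left) h
        have heq := Finset.eq_of_subset_of_card_le h₂ hle
        exact hRX ((subset_closure R).trans (by rw [hRcl, ← heq]; exact h₁))
      exact φ.isClosed_iff_closure_le.2
        (Finset.subset_inter (Finset.subset_inter h₃ h₂) h₁)
  obtain ⟨C, hCR, hcrit, hCcl⟩ := hqc.exists_isCritical
  refine hQ.2 ?_
  rw [← hRcl, ← hCcl]
  exact hA C hcrit (hCR.trans Finset.inter_subset_left)

/-- For `c ∈ C`, either `C ∩ φ {c}` is closed and so contains `φ {c}`, or `C ⊆ φ {c}`. In the second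
case `{c}` is a smaller quasi-closed set with the same closure, as its only other subset `∅` is
closed; this contradicts criticality. -/
theorem IsCritical.isDown {C : Finset S} (hφ : φ ∅ = ∅) (hC : IsCritical φ C)
    (hcard : 2 ≤ C.card) : IsDown φ C := by
  intro c hc
  by_cases h : C ⊆ φ {c}
  · exfalso
    have hcC : ({c} : Finset S) ⊆ C := Finset.singleton_subset_iff.2 hc
    have heq : φ {c} = φ C :=
      subset_antisymm (closure_mono hcC) (closure_subset_of_isClosed h (φ.isClosed_closure _))
    have hne : ({c} : Finset S) ≠ C := by
      rintro rfl
      simp at hcard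
    refine hne (hC.2 {c} hcC ⟨fun hcl => ?_, fun X _ hX => ?_⟩ heq)
    · rw [hcl.closure_eq] at h
      exact hne (subset_antisymm hcC h)
    · rw [Finset.singleton_inter_of_notMem (by simpa using hX)]
      exact φ.isClosed_iff.2 hφ
  · have := hC.1.2 (φ {c}) (φ.isClosed_closure _) h
    exact (closure_subset_of_isClosed (Finset.singleton_subset_iff.2
      (Finset.mem_inter.2 ⟨hc, mem_closure_singleton c⟩)) this).trans Finset.inter_subset_left

theorem mem_canonicalBasis [Fintype S] {I : Finset S × Finset S} :
    I ∈ canonicalBasis φ ↔ IsCritical φ I.1 ∧ I.2 = φ I.1 \ I.1 := by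
  classical
  simp only [canonicalBasis, Finset.mem_image, Finset.mem_filter, Finset.mem_univ, true_and]
  constructor
  · rintro ⟨C, hC, rfl⟩
    exact ⟨hC, rfl⟩
  · rintro ⟨h, h'⟩
    exact ⟨I.1, h, by rw [← h']⟩

theorem determines_canonicalBasis [Fintype S] {l : List (Finset S × Finset S)}
    (hl : l.toFinset = canonicalBasis φ) : Determines l φ := by
  have hmem : ∀ I, I ∈ l ↔ IsCritical φ I.1 ∧ I.2 = φ I.1 \ I.1 := fun I => by
    rw [← List.mem_toFinset, hl, mem_canonicalBasis]
  intro A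
  constructor
  · intro hA I hI hIA
    rw [((hmem I).1 hI).2]
    exact Finset.sdiff_subset.trans (closure_subset_of_isClosed hIA hA)
  · refine fun h => isClosed_of_isCritical fun C hC hCA => ?_
    have := h (C, φ C \ C) ((hmem _).2 ⟨hC, rfl⟩) hCA
    exact (sdiff_le_iff.1 this).trans (Finset.union_subset hCA subset_rfl)

/-! ### Minimal covers -/

/-- Shrink `C` to a minimal down-set whose closure contains `x`, and take its maximal elements. Any
refinement `Y` that still yields `x` generates the same down-set, so it contains those maximal
elements. -/
theorem IsStandard.exists_isMinCover (hφ : IsStandard φ) {C : Finset S} {x : S}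
    (hC : IsDown φ C) (hx : x ∈ φ C) (hxC : x ∉ C) : ∃ Z ⊆ C, IsMinCover φ Z x := by
  induction C using Finset.strongInduction with
  | H C ih =>
    by_cases hsmall : ∃ W, W ⊂ C ∧ IsDown φ W ∧ x ∈ φ W
    · obtain ⟨W, hW, hdown, hxW⟩ := hsmall
      obtain ⟨Z, hZ, hmin⟩ := ih W hW hdown hxW fun h => hxC (hW.subset h)
      exact ⟨Z, hZ.trans hW.subset, hmin⟩
    push Not at hsmall
    set Z := C.filter fun z => ∀ y ∈ C, z ∈ φ {y} → y = z with hZ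
    have hZC : Z ⊆ C := Finset.filter_subset _ _
    have hbelow : ∀ c ∈ C, ∃ z ∈ Z, c ∈ φ {z} := by
      intro c hc
      -- An element of `C` above `c` with the largest principal closure is maximal in `C`.
      obtain ⟨z, hz, hmax⟩ := Finset.exists_max_image (C.filter fun y => c ∈ φ {y})
        (fun y => (φ {y}).card) ⟨c, Finset.mem_filter.2 ⟨hc, mem_closure_singleton c⟩⟩
      simp only [Finset.mem_filter, and_imp] at hz hmax
      refine ⟨z, Finset.mem_filter.2 ⟨hz.1, fun y hy hzy => ?_⟩, hz.2⟩
      have hsub : φ {z} ⊆ φ {y} := closure_singleton_subset hzy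
      have heq := Finset.eq_of_subset_of_card_le hsub (hmax y hy (hsub hz.2))
      exact hφ.antisymm (heq ▸ mem_closure_singleton y) hzy
    refine ⟨Z, hZC, ⟨?_, fun y hy hxy => hxC (hC y (hZC hy) hxy)⟩, fun Y hY hYZ z hz => ?_⟩
    · refine closure_subset_of_isClosed (fun c hc => ?_) (φ.isClosed_closure Z) hx
      obtain ⟨z, hz, hcz⟩ := hbelow c hc
      exact closure_mono (Finset.singleton_subset_iff.2 hz) hcz
    · set W := Y.biUnion fun y => φ {y} with hW
      have hYC : ∀ y ∈ Y, y ∈ C := fun y hy => by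
        obtain ⟨z, hz, hyz⟩ := hYZ y hy
        exact hC z (hZC hz) hyz
      have hWC : W ⊆ C := Finset.biUnion_subset.2 fun y hy => hC y (hYC y hy)
      have hWdown : IsDown φ W := by
        intro w hw
        obtain ⟨y, hy, hwy⟩ := Finset.mem_biUnion.1 hw
        exact (closure_singleton_subset hwy).trans
          (Finset.subset_biUnion_of_mem (fun y => φ {y}) hy)
      have hYW : Y ⊆ W := fun y hy => Finset.mem_biUnion.2 ⟨y, hy, mem_closure_singleton y⟩
      have hzW : z ∈ W := by
        by_contra hzW
        exact hsmall W (hWC.ssubset_of_ne fun h => hzW (h ▸ hZC hz)) hWdown (closure_mono hYW hY)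
      obtain ⟨y, hy, hzy⟩ := Finset.mem_biUnion.1 hzW
      exact (Finset.mem_filter.1 hz).2 y (hYC y hy) hzy ▸ hy

/-! ### The iteration -/

section Iteration

variable [Fintype S] {l : List (Finset S × Finset S)}

theorem mem_next {T : Finset S} {x : S} :
    x ∈ next φ l T ↔ ∀ I ∈ l, 2 ≤ I.1.card → x ∈ I.2 → x ∈ φ (I.1 ∩ T) := by
  have main : ∀ (l : List (Finset S × Finset S)) (U : Finset S), x ∈ l.foldl (cut φ T) U ↔
      x ∈ U ∧ ∀ I ∈ l, 2 ≤ I.1.card → x ∈ I.2 → x ∈ φ (I.1 ∩ T) := by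
    intro l
    induction l with
    | nil => simp
    | cons I l ih =>
      intro U
      rw [List.foldl_cons, ih, List.forall_mem_cons, ← and_assoc]
      refine and_congr_left fun _ => ?_
      unfold cut
      split_ifs with h
      · simp [h]
      · simp [h]
  simp [next, main]

theorem next_mono : Monotone (next φ l) := fun T T' h x hx => by
  rw [mem_next] at hx ⊢
  exact fun I hI hc hxI =>
    closure_mono (Finset.inter_subset_inter_left h) (hx I hI hc hxI)

theorem next_iterate_subset (k : ℕ) : (next φ l)^[k] ∅ ⊆ (next φ l)^[k + 1] ∅ :=
  next_mono.monotone_iterate_of_le_map (Finset.empty_subset _) (Nat.le_succ k)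

/-- What follows from a down-set and is not excluded follows from the elements in `T`. -/
theorem mem_closure_inter_of_mem_next (hφ : φ ∅ = ∅) (hl : l.toFinset = canonicalBasis φ)
    {T W : Finset S} (hT : T ⊆ next φ l T) (hW : IsDown φ W) {z : S} (hz : z ∈ next φ l T)
    (hzW : z ∈ φ W) : z ∈ W ∨ z ∈ φ (W ∩ T) := by
  -- `V` collects the elements for which the claim holds, and `V'` is the largest down-set inside
  -- it. Passing to `V'` takes care of the one-element premises; `V'` is shown to be closed and
  -- contains `W`.
  set V := Finset.univ.filter fun z => z ∈ next φ l T → z ∈ W ∨ z ∈ φ (W ∩ T) with hV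
  set V' := Finset.univ.filter fun z => φ {z} ⊆ V with hV'
  have hV'V : V' ⊆ V := fun z hz => (Finset.mem_filter.1 hz).2 (mem_closure_singleton z)
  have hWV' : W ⊆ V' := fun w hw => Finset.mem_filter.2 ⟨Finset.mem_univ _, fun u hu =>
    Finset.mem_filter.2 ⟨Finset.mem_univ _, fun _ => .inl (hW w hw hu)⟩⟩
  have hclosed : φ.IsClosed V' := by
    refine isClosed_of_isCritical fun C hC hCV' => ?_
    have hsub : φ C ⊆ V := by
      rcases Nat.lt_or_ge C.card 2 with hcard | hcard
      · have hne : C ≠ ∅ := by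
          rintro rfl
          exact hC.1.1 (φ.isClosed_iff.2 hφ)
        obtain ⟨c, rfl⟩ := Finset.card_eq_one.1
          (le_antisymm (Nat.lt_succ_iff.1 hcard) (Finset.card_pos.2
            (Finset.nonempty_iff_ne_empty.2 hne)))
        exact (Finset.mem_filter.1 (Finset.singleton_subset_iff.1 hCV')).2
      · intro u hu
        by_cases huC : u ∈ C
        · exact hV'V (hCV' huC)
        refine Finset.mem_filter.2 ⟨Finset.mem_univ _, fun hun => .inr ?_⟩
        have hmem : (C, φ C \ C) ∈ l := by
          rw [← List.mem_toFinset, hl, mem_canonicalBasis]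
          exact ⟨hC, rfl⟩
        -- An element of `next T` obtained from `C` already follows from `C ∩ T`. As `T ⊆ next T`,
        -- the claim applies to each element of `C ∩ T`, which therefore lies in `φ (W ∩ T)`.
        have := mem_next.1 hun _ hmem hcard (Finset.mem_sdiff.2 ⟨hu, huC⟩)
        refine closure_subset_of_isClosed (fun c hc => ?_) (φ.isClosed_closure _) this
        obtain ⟨hcC, hcT⟩ := Finset.mem_inter.1 hc
        rcases (Finset.mem_filter.1 (hV'V (hCV' hcC))).2 (hT hcT) with h | h
        · exact subset_closure _ (Finset.mem_inter.2 ⟨h, hcT⟩)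
        · exact h
    exact fun u hu => Finset.mem_filter.2 ⟨Finset.mem_univ _,
      (closure_singleton_subset hu).trans hsub⟩
  have := hV'V (closure_subset_of_isClosed hWV' hclosed hzW)
  exact (Finset.mem_filter.1 this).2 hz

/-- Let `W` be the down-set generated by a minimal cover `Z`. Non-triviality rules out `x ∈ W`, so
`x ∈ φ (W ∩ T)`; since `W ∩ T` refines `Z`, minimality gives `Z ⊆ W ∩ T`. -/
theorem DRel.mem_of_mem_next (hφ : φ ∅ = ∅) (hl : l.toFinset = canonicalBasis φ)
    {T : Finset S} (hT : T ⊆ next φ l T) {x y : S} (hx : x ∈ next φ l T) (h : DRel φ x y) :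
    y ∈ T := by
  obtain ⟨Z, ⟨⟨hxZ, hnt⟩, hmin⟩, hy⟩ := h
  set W := Z.biUnion fun z => φ {z} with hW
  have hdown : IsDown φ W := by
    intro w hw
    obtain ⟨y, hy, hwy⟩ := Finset.mem_biUnion.1 hw
    exact (closure_singleton_subset hwy).trans
      (Finset.subset_biUnion_of_mem (fun y => φ {y}) hy)
  have hZW : Z ⊆ W := fun y hy => Finset.mem_biUnion.2 ⟨y, hy, mem_closure_singleton y⟩
  rcases mem_closure_inter_of_mem_next hφ hl hT hdown hx (closure_mono hZW hxZ) with h | h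
  · obtain ⟨z, hz, hxz⟩ := Finset.mem_biUnion.1 h
    exact absurd hxz (hnt z hz)
  · have := hmin (W ∩ T) h fun w hw => by
      simpa using Finset.mem_biUnion.1 (Finset.mem_inter.1 hw).1
    exact (Finset.mem_inter.1 (this hy)).2

theorem acc_of_mem_next_iterate (hφ : φ ∅ = ∅) (hl : l.toFinset = canonicalBasis φ) (k : ℕ)
    {x : S} (hx : x ∈ (next φ l)^[k] ∅) : Acc (fun b a => DRel φ a b) x := by
  induction k generalizing x with
  | zero => simp at hx
  | succ k ih =>
    have hT := next_iterate_subset (φ := φ) (l := l) k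
    rw [Function.iterate_succ_apply'] at hx hT
    exact ⟨x, fun y hy => ih (hy.mem_of_mem_next hφ hl hT hx)⟩

end Iteration

/-! ### The criterion -/

/-- The criterion that the machine checks. -/
theorem withoutDCycles_iff [Fintype S] (hφ : IsStandard φ) {l : List (Finset S × Finset S)}
    (hl : l.toFinset = canonicalBasis φ) {es : List S} (hes : Covers es l) {k : ℕ}
    (hk : ∀ e ∈ es, e ∈ (next φ l)^[k + 1] ∅ → e ∈ (next φ l)^[k] ∅) :
    (∀ e ∈ es, e ∈ (next φ l)^[k + 1] ∅) ↔ WithoutDCycles φ := by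
  constructor
  · refine fun h => withoutDCycles_of_wellFounded ⟨fun x => ?_⟩
    refine acc_of_mem_next_iterate hφ.1 hl (k + 1) ?_
    by_cases hx : x ∈ es
    · exact h x hx
    -- An element outside the enumeration occurs in no conclusion, so nothing excludes it.
    · rw [Function.iterate_succ_apply', mem_next]
      exact fun I hI _ hxI => absurd (List.mem_toFinset.1 ((hes I hI).2 hxI)) hx
  · intro h x
    induction x using h.wellFounded.induction with
    | _ x ih =>
      intro hx
      rw [Function.iterate_succ_apply', mem_next]
      intro I hI hcard hxI
      have hI' := hI
      rw [← List.mem_toFinset, hl, mem_canonicalBasis] at hI'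
      rw [hI'.2, Finset.mem_sdiff] at hxI
      obtain ⟨Z, hZ, hmin⟩ := hφ.exists_isMinCover (hI'.1.isDown hφ.1 hcard) hxI.1 hxI.2
      refine closure_mono (fun z hz => Finset.mem_inter.2 ⟨hZ hz, ?_⟩) hmin.1.1
      have hzes := List.mem_toFinset.1 ((hes I hI).1 (hZ hz))
      -- The induction hypothesis gives `z` at stage `k + 1`; stability brings it back to stage `k`,
      -- as needed to put `x` into stage `k + 1`.
      exact hk z hzes (ih z ⟨Z, hmin, hz⟩ hzes)

end Criterion

/-! ### Comparison with the lattice of closed sets -/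

section Lattice

variable {S : Type*} {φ : ClosureOperator (Finset S)}

theorem toCloseds_le_iff {A : Finset S} {c : φ.Closeds} : φ.toCloseds A ≤ c ↔ A ⊆ c.1 :=
  φ.gi.gc A c

/-- The closed set generated by an element. -/
def principal (φ : ClosureOperator (Finset S)) (i : S) : φ.Closeds := φ.toCloseds {i}

theorem principal_le_iff {i : S} {c : φ.Closeds} : principal φ i ≤ c ↔ i ∈ c.1 :=
  toCloseds_le_iff.trans Finset.singleton_subset_iff

theorem principal_le_principal_iff {i j : S} : principal φ i ≤ principal φ j ↔ i ∈ φ {j} :=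
  principal_le_iff

variable [DecidableEq S]

theorem IsStandard.principal_injective (hφ : IsStandard φ) : Function.Injective (principal φ) :=
  fun _ _ h => hφ.antisymm (principal_le_principal_iff.1 h.le) (principal_le_principal_iff.1 h.ge)

open Classical in
theorem sup_image_principal (X : Finset S) :
    (X.image (principal φ)).sup id = φ.toCloseds X := by
  refine eq_of_forall_ge_iff fun c => ?_
  simp only [Finset.sup_le_iff, Finset.mem_image, forall_exists_index, and_imp,
    forall_apply_eq_imp_iff₂, id_eq, principal_le_iff]
  exact toCloseds_le_iff.symm

/-- Every closed set strictly below `φ {i}` lies in `φ {i} \ {i}`. As this set is closed, it also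
contains the join of two such sets. -/
theorem IsStandard.supIrred_principal (hφ : IsStandard φ) (i : S) : SupIrred (principal φ i) := by
  refine ⟨fun h => ?_, fun b c hbc => ?_⟩
  · have h' : principal φ i ≤ φ.toCloseds ∅ := h (toCloseds_le_iff.2 (Finset.empty_subset _))
    have h'' : i ∈ φ ∅ := principal_le_iff.1 h'
    rw [hφ.1] at h''
    simp at h''
  · have key : ∀ d : φ.Closeds, d ≤ principal φ i → d ≠ principal φ i → d.1 ⊆ φ {i} \ {i} := by
      intro d hd hne x hx
      refine Finset.mem_sdiff.2 ⟨hd hx, fun hxi => hne (le_antisymm hd ?_)⟩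
      rw [Finset.mem_singleton] at hxi
      exact principal_le_iff.2 (hxi ▸ hx)
    by_contra hne
    push Not at hne
    have hb := key b (hbc ▸ le_sup_left) hne.1
    have hc := key c (hbc ▸ le_sup_right) hne.2
    have : b ⊔ c ≤ ⟨φ {i} \ {i}, hφ.2 i⟩ := sup_le hb hc
    rw [hbc, principal_le_iff] at this
    simp at this

/-- A closed set is the finite join of the principal ones of its elements; an irreducible one must
equal one of them. -/
theorem exists_principal_eq {a : φ.Closeds} (ha : SupIrred a) : ∃ i, principal φ i = a := by
  classical
  have h : (a.1.image (principal φ)).sup id = a := by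
    rw [sup_image_principal]
    exact Subtype.ext a.2.closure_eq
  obtain ⟨b, hb, rfl⟩ := ha.finset_sup_eq h
  obtain ⟨i, _, rfl⟩ := Finset.mem_image.1 hb
  exact ⟨i, rfl⟩

variable [Fintype S]

open Classical in
theorem exists_image_principal_eq {Y : Finset φ.Closeds} (hY : ∀ y ∈ Y, SupIrred y) :
    ∃ X : Finset S, X.image (principal φ) = Y := by
  refine ⟨Finset.univ.filter fun i => principal φ i ∈ Y, ?_⟩
  ext y
  simp only [Finset.mem_image, Finset.mem_filter, Finset.mem_univ, true_and]
  constructor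
  · rintro ⟨i, hi, rfl⟩
    exact hi
  · intro hy
    obtain ⟨i, rfl⟩ := exists_principal_eq (hY y hy)
    exact ⟨i, hy, rfl⟩

open Classical in
theorem IsStandard.isLatticeMinCover_image_iff (hφ : IsStandard φ) {X : Finset S} {x : S} :
    IsLatticeMinCover (X.image (principal φ)) (principal φ x) ↔ IsMinCover φ X x := by
  have hirr : ∀ Y : Finset S, ∀ y ∈ Y.image (principal φ), SupIrred y := by
    intro Y y hy
    obtain ⟨i, _, rfl⟩ := Finset.mem_image.1 hy
    exact hφ.supIrred_principal i
  have hsup : ∀ Y : Finset S,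
      principal φ x ≤ (Y.image (principal φ)).sup id ↔ x ∈ φ Y := by
    intro Y
    rw [sup_image_principal, principal_le_iff]
    rfl
  have href : ∀ Y : Finset S, Refines (Y.image (principal φ)) (X.image (principal φ)) ↔
      ∀ y ∈ Y, ∃ z ∈ X, y ∈ φ {z} := by
    intro Y
    simp [Refines, principal_le_principal_iff]
  refine and_congr ?_ ?_
  · simp only [IsLatticeCover, IsCover, hsup]
    simp only [Finset.forall_mem_image, principal_le_principal_iff]
    exact ⟨fun h => h.2, fun h => ⟨fun i _ => hφ.supIrred_principal i, h⟩⟩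
  · constructor
    · intro h Y hY hYX
      have := h (Y.image (principal φ)) (hirr Y) ((hsup Y).2 hY) ((href Y).2 hYX)
      exact (Finset.image_subset_image_iff hφ.principal_injective).1 this
    · intro h Y hYirr hY hYX
      obtain ⟨Y, rfl⟩ := exists_image_principal_eq hYirr
      exact Finset.image_subset_image (h Y ((hsup Y).1 hY) ((href Y).1 hYX))

theorem IsStandard.latticeD_principal_iff (hφ : IsStandard φ) {x y : S} :
    LatticeD (principal φ x) (principal φ y) ↔ DRel φ x y := by
  classical
  constructor
  · rintro ⟨_, _, X, hX, hy⟩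
    obtain ⟨X, rfl⟩ := exists_image_principal_eq hX.1.1
    obtain ⟨z, hz, hzy⟩ := Finset.mem_image.1 hy
    exact ⟨X, hφ.isLatticeMinCover_image_iff.1 hX, hφ.principal_injective hzy ▸ hz⟩
  · rintro ⟨X, hX, hy⟩
    exact ⟨hφ.supIrred_principal x, hφ.supIrred_principal y, X.image (principal φ),
      hφ.isLatticeMinCover_image_iff.2 hX, Finset.mem_image_of_mem _ hy⟩

theorem IsStandard.withoutDCycles_iff_lattice (hφ : IsStandard φ) :
    WithoutDCycles φ ↔ LatticeWithoutDCycles φ.Closeds := by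
  refine not_congr ⟨?_, ?_⟩
  · rintro ⟨n, x, hn, hx, hxn⟩
    exact ⟨n, fun i => principal φ (x i), hn,
      fun i hi hin => hφ.latticeD_principal_iff.2 (hx i hi hin), congrArg _ hxn⟩
  · rintro ⟨n, x, hn, hx, hxn⟩
    have : Nonempty S := by
      obtain ⟨i, _⟩ := exists_principal_eq (hx 1 le_rfl (by omega)).1
      exact ⟨i⟩
    -- Terms of the sequence outside the cycle need not be irreducible; their preimages are
    -- arbitrary and never used.
    have hinv : ∀ i, SupIrred (x i) → principal φ (Function.invFun (principal φ) (x i)) = x i :=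
      fun i hi => Function.invFun_eq (exists_principal_eq hi)
    refine ⟨n, fun i => Function.invFun (principal φ) (x i), hn, fun i hi hin => ?_,
      congrArg _ hxn⟩
    have := hx i hi hin
    rwa [← hφ.latticeD_principal_iff, hinv i this.1, hinv (i + 1) this.2.1]

end Lattice

/-! ### The bound on the number of steps -/

section Time

open Polynomial

/-- A polynomial bound on the number of steps of the machine. -/
noncomputable def timeBound : Polynomial ℕ := 100 * (X + 1) ^ 5

theorem programTime_le {n m N : ℕ} (hn : n ≤ N) (hm : m ≤ N) :
    programTime n m ≤ timeBound.eval N := by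
  have hmono : programTime n m ≤ programTime N N := by
    unfold programTime roundTime closureTime
    gcongr
  refine hmono.trans ?_
  have : timeBound.eval N = 100 * (N + 1) ^ 5 := by simp [timeBound]
  rw [this]
  -- For `n = m = N` the bound is `17N⁵ + 51N⁴ + 68N³ + 77N² + 60N + 23`, below `100(N+1)⁵`
  -- coefficient by coefficient.
  unfold programTime roundTime closureTime
  ring_nf
  have h₂ : N ≤ N ^ 2 := Nat.le_self_pow (by norm_num) N
  have h₃ : N ^ 2 ≤ N ^ 3 := by rw [pow_succ N 2]; nlinarith
  nlinarith

/-- Each occurring element is counted in the size at least once. Each implication adds at least one,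
because `∅` is closed and so no premise is empty. -/
theorem length_add_length_le {S : Type*} [Fintype S] [DecidableEq S]
    {φ : ClosureOperator (Finset S)} (hφ : φ ∅ = ∅) {es : List S} (hes : es.Nodup)
    {l : List (Finset S × Finset S)} (hl : l.Nodup) (hlφ : l.toFinset = canonicalBasis φ) :
    es.length ≤ basisSize (canonicalBasis φ) +
        (es.toFinset \ occurring (canonicalBasis φ)).card ∧
      l.length ≤ basisSize (canonicalBasis φ) := by
  constructor
  · rw [← List.toFinset_card_of_nodup hes, ← Finset.card_inter_add_card_sdiff es.toFinset
      (occurring (canonicalBasis φ))]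
    refine Nat.add_le_add_right ((Finset.card_le_card Finset.inter_subset_right).trans ?_) _
    exact Finset.card_biUnion_le.trans (Finset.sum_le_sum fun I _ => Finset.card_union_le _ _)
  · rw [← List.toFinset_card_of_nodup hl, hlφ, basisSize, Finset.card_eq_sum_ones]
    refine Finset.sum_le_sum fun I hI => ?_
    have hne : I.1.Nonempty := by
      rw [Finset.nonempty_iff_ne_empty]
      intro h
      refine (mem_canonicalBasis.1 hI).1.1.1 ?_
      rw [h]
      exact φ.isClosed_iff.2 hφ
    have := hne.card_pos
    omega

end Time

end ClosureSys

theorem theorem6p12 :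
    ∃ (M : Turing.TM2ComputableAux (Option Bool) Bool) (p : Polynomial ℕ),
      ∀ (S : Type*) [Fintype S] [DecidableEq S] (φ : ClosureOperator (Finset S)),
        ClosureSys.IsStandard φ →
        (ClosureSys.WithoutDCycles φ ↔ ClosureSys.LatticeWithoutDCycles φ.Closeds) ∧
        ∀ (es : List S) (l : List (Finset S × Finset S)),
          es.Nodup → ClosureSys.occurring (ClosureSys.canonicalBasis φ) ⊆ es.toFinset →
          l.Nodup → l.toFinset = ClosureSys.canonicalBasis φ →
          ∃ answer : Bool, (answer = true ↔ ClosureSys.WithoutDCycles φ) ∧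
            Nonempty (Turing.TM2OutputsInTime M.tm
              ((ClosureSys.encodeBasis es l).map M.inputAlphabet.invFun)
              (some ((Computability.encodeBool answer).map M.outputAlphabet.invFun))
              (p.eval (ClosureSys.basisSize (ClosureSys.canonicalBasis φ) +
                (es.toFinset \ ClosureSys.occurring (ClosureSys.canonicalBasis φ)).card))) := by
  refine ⟨DCycleMachine.machine, ClosureSys.timeBound, fun S _ _ φ hφ =>
    ⟨hφ.withoutDCycles_iff_lattice, fun es l hes hocc hl hlφ => ?_⟩⟩
  have hcov : DCycleMachine.Covers es l := by
    intro I hI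
    have : I.1 ∪ I.2 ⊆ es.toFinset := by
      refine subset_trans ?_ hocc
      rw [← List.mem_toFinset, hlφ] at hI
      exact Finset.subset_biUnion_of_mem (fun I : Finset S × Finset S => I.1 ∪ I.2) hI
    exact ⟨Finset.subset_union_left.trans this, Finset.subset_union_right.trans this⟩
  have hdet := ClosureSys.determines_canonicalBasis hlφ
  obtain ⟨hn, hm⟩ := ClosureSys.length_add_length_le hφ.1 hes hl hlφ
  -- Without implications the word is empty, whatever the enumeration is.
  obtain ⟨es', hes', hcov', hempty, hword, hlen⟩ : ∃ es' : List S, es'.Nodup ∧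
      DCycleMachine.Covers es' l ∧ (l = [] → es' = []) ∧
      ClosureSys.encodeBasis es l = ClosureSys.encodeBasis es' l ∧ es'.length ≤ es.length := by
    by_cases h : l = []
    · subst h
      exact ⟨[], List.nodup_nil, by simp [DCycleMachine.Covers], fun _ => rfl, rfl, by simp⟩
    · exact ⟨es, hes, hcov, fun h' => absurd h' h, rfl, le_rfl⟩
  obtain ⟨k, hk, hrun⟩ := DCycleMachine.exec_program hes' hcov' hdet
    ClosureSys.next_iterate_subset hempty
  refine ⟨es'.all fun e => decide (e ∈ (DCycleMachine.next φ l)^[k + 1] ∅), ?_, ?_⟩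
  · rw [← ClosureSys.withoutDCycles_iff hφ hlφ hcov' hk, List.all_eq_true]
    exact forall₂_congr fun e _ => decide_eq_true_iff
  · rw [hword]
    exact DCycleMachine.machine_outputs (hrun.mono (ClosureSys.programTime_le
      (hlen.trans hn) (hm.trans (Nat.le_add_right _ _))))
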